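/- **Lemma 4.4.** Let $d\in\{2,3\}$ and let $\sigma,\tau$ be real constants. There is a constant $c>0$, depending only on $d,\sigma,\tau$, such that the following holds. Let $\Omega\subset\mathbb R^d$ be a bounded open set, let $\Omega_k\subset\Omega$ be a nonempty open subset (for example one of the two subdomains into which a smooth interface divides $\Omega$), and let $\mathcal T_h$ be a conforming triangulation of $\Omega$ by finitely many closed nondegenerate $d$-simplices, $\bigcup_{K\in\mathcal T_h}K=\overline\Omega$, with mesh size $h=\max_K h_K$, $h_K=\operatorname{diam}K$. Assume that $\mathcal T_h$ is shape regular (every $K$ contains a ball of some radius $\rho>0$ with $h_K\le\sigma\rho$) and quasiuniform ($h\le\tau h_K$ for every $K$). For $\delta\ge 0$ put $$\mathcal T_{h,k}=\{K\in\mathcal T_h:\ \exists\,x\in K,\ \operatorname{dist}(x,\Omega_k)\le\delta\},\qquad \Omega_{h,k}=\operatorname{int}\Big(\bigcup_{K\in\mathcal T_{h,k}}K\Big).$$ Let $\{\varphi_j\}_{j}$ be the nodal basis of the space of functions that are continuous on the open set $\Omega_{h,k}$ and affine on each $K\in\mathcal T_{h,k}$, no boundary condition being imposed. Explicitly, there is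 one $\varphi_j$ for every vertex $x_j$ and every class of simplices of $\mathcal T_{h,k}$ containing $x_j$ that are connected to each other through facets containing $x_j$ (a single class, unless $\Omega_{h,k}$ is pinched at $x_j$); on the simplices of the class $\varphi_j$ is the barycentric coordinate of $x_j$, and it is $0$ on the other simplices. For $\mathbf v\in (L^2(\Omega_{h,k}))^d$ let $$\mathcal P_k\mathbf v=\sum_{j}\frac{\int_{\Omega_{h,k}}\mathbf v\,\varphi_j\,dx}{\int_{\Omega_{h,k}}\varphi_j\,dx}\,\varphi_j,\qquad s_{h,k}(u,v)=\int_{\Omega_{h,k}}(\nabla u-\mathcal P_k\nabla u)\cdot\nabla v\,dx,\quad u,v\in H^1(\Omega_{h,k}).$$ Let $\mathcal P_k^0$ be the operator obtained by summing only over those $j$ with $x_j\notin\partial\Omega\cap\partial\Omega_{h,k}$ (homogeneous boundary condition), and let $s^0_{h,k}$ be the corresponding form. Then: 1. (Continuity) $|s_{h,k}(u,v)|\le c\,\|u\|_{H^1(\Omega_{h,k})}\|v\|_{H^1(\Omega_{h,k})}$ and $|s^0_{h,k}(u,v)|\le c\,\|u\|_{H^1(\Omega_{h,k})}\|v\|_{H^1(\Omega_{h,k})}$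 for all $u,v\in H^1(\Omega_{h,k})$. 2. (Weak consistency) $s_{h,k}(u,u)\le c\,h^2\,\|u\|^2_{H^2(\Omega_{h,k})}$ for all $u\in H^2(\Omega_{h,k})$. -/

import Mathlib

open MeasureTheory

open scoped ContDiff

noncomputable section

namespace PG

/-- Euclidean space of dimension `d`. -/
abbrev E (d : ℕ) : Type := EuclideanSpace ℝ (Fin d)

/-! ### Sobolev spaces through weak derivatives -/

/-- `G` is a weak gradient of `u` on the open set `U`: for every test function `φ ∈ C_c^∞(U)` and
every coordinate `i` one has `∫_U u ∂ᵢφ = - ∫_U Gᵢ φ`. -/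
def IsWeakGrad {d : ℕ} (U : Set (E d)) (u : E d → ℝ) (G : E d → E d) : Prop :=
  ∀ φ : E d → ℝ, ContDiff ℝ ∞ φ → HasCompactSupport φ → tsupport φ ⊆ U →
    ∀ i : Fin d,
      ∫ x in U, u x * fderiv ℝ φ x (EuclideanSpace.single i (1 : ℝ)) = - ∫ x in U, G x i * φ x

/-- `u ∈ H¹(U)`: `u` is square integrable on `U` and has a square integrable weak gradient. -/
def MemH1 {d : ℕ} (U : Set (E d)) (u : E d → ℝ) : Prop :=
  MemLp u 2 (volume.restrict U) ∧
    ∃ G : E d → E d, MemLp G 2 (volume.restrict U) ∧ IsWeakGrad U u G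

open Classical in
/-- The weak gradient `∇u` of `u ∈ H¹(U)`; it is unique up to null sets of `U`. -/
def weakGrad {d : ℕ} (U : Set (E d)) (u : E d → ℝ) : E d → E d :=
  if h : ∃ G : E d → E d, MemLp G 2 (volume.restrict U) ∧ IsWeakGrad U u G then h.choose else 0

/-- The weak partial derivative `∂ᵢu` of `u ∈ H¹(U)`. -/
def weakPartial {d : ℕ} (U : Set (E d)) (u : E d → ℝ) (i : Fin d) : E d → ℝ :=
  fun x => weakGrad U u x i

/-- `‖u‖²_{H¹(U)} = ‖u‖²_{L²(U)} + ‖∇u‖²_{L²(U)}`. -/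
def normSqH1 {d : ℕ} (U : Set (E d)) (u : E d → ℝ) : ℝ :=
  (∫ x in U, u x ^ 2) + ∫ x in U, ‖weakGrad U u x‖ ^ 2

/-- `‖u‖_{H¹(U)}`. -/
def normH1 {d : ℕ} (U : Set (E d)) (u : E d → ℝ) : ℝ :=
  Real.sqrt (normSqH1 U u)

/-- `u ∈ H²(U)`: `u` and all its weak first derivatives belong to `H¹(U)`. -/
def MemH2 {d : ℕ} (U : Set (E d)) (u : E d → ℝ) : Prop :=
  MemH1 U u ∧ ∀ i : Fin d, MemH1 U (weakPartial U u i)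

/-- `‖u‖²_{H²(U)} = ‖u‖²_{L²(U)} + ‖∇u‖²_{L²(U)} + ‖∇²u‖²_{L²(U)}`. -/
def normSqH2 {d : ℕ} (U : Set (E d)) (u : E d → ℝ) : ℝ :=
  normSqH1 U u + ∑ i : Fin d, ∫ x in U, ‖weakGrad U (weakPartial U u i) x‖ ^ 2

/-- `‖u‖_{H²(U)}`. -/
def normH2 {d : ℕ} (U : Set (E d)) (u : E d → ℝ) : ℝ :=
  Real.sqrt (normSqH2 U u)

/-! ### Triangulations -/

/-- The closed simplex spanned by a finite set of vertices. -/
def cell {d : ℕ} (K : Finset (E d)) : Set (E d) := convexHull ℝ (K : Set (E d))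

/-- A conforming triangulation of `Ω` by finitely many nondegenerate closed `d`-simplices, each of
them given by its set of `d + 1` vertices: the simplices cover exactly the closure of `Ω`, and two
of them meet in the simplex spanned by their common vertices (which may be empty). -/
structure Triangulation {d : ℕ} (Ω : Set (E d)) where
  cells : Finset (Finset (E d))
  card_eq : ∀ K ∈ cells, K.card = d + 1
  affineIndependent : ∀ K ∈ cells, AffineIndependent ℝ (fun p : K => (p : E d))
  conforming : ∀ K ∈ cells, ∀ L ∈ cells,
    cell K ∩ cell L = convexHull ℝ ((K : Set (E d)) ∩ (L : Set (E d)))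
  cover : ⋃ K ∈ cells, cell K = closure Ω

namespace Triangulation

variable {d : ℕ} {Ω : Set (E d)}

/-- The mesh size `h = max_K diam K`. -/
def meshSize (T : Triangulation Ω) : ℝ := ⨆ K : T.cells, Metric.diam (cell (K : Finset (E d)))

/-- Shape regularity with constant `σ`: every `K` contains a ball of some radius `ρ > 0` with
`diam K ≤ σ ρ`. -/
def ShapeRegular (T : Triangulation Ω) (σ : ℝ) : Prop :=
  ∀ K ∈ T.cells, ∃ (x : E d) (ρ : ℝ), 0 < ρ ∧ Metric.ball x ρ ⊆ cell K ∧
    Metric.diam (cell K) ≤ σ * ρ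

/-- Quasiuniformity with constant `τ`: `h ≤ τ diam K` for every `K`. -/
def QuasiUniform (T : Triangulation Ω) (τ : ℝ) : Prop :=
  ∀ K ∈ T.cells, T.meshSize ≤ τ * Metric.diam (cell K)

open Classical in
/-- The sub-triangulation of the simplices that contain a point at distance at most `δ`
from `A`. -/
def subcells (T : Triangulation Ω) (A : Set (E d)) (δ : ℝ) : Finset (Finset (E d)) :=
  T.cells.filter (fun K => ∃ x ∈ cell K, Metric.infDist x A ≤ δ)

end Triangulation

/-- The open mesh domain `int (⋃_{K ∈ S} K)` of a finite set `S` of simplices. -/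
def meshDomain {d : ℕ} (S : Finset (Finset (E d))) : Set (E d) := interior (⋃ K ∈ S, cell K)

/-! ### Nodal basis of the continuous piecewise affine functions -/

open Classical in
/-- The barycentric coordinate of the point `x` that belongs to the vertex `z` of the nondegenerate
`d`-simplex with vertex set `K`. -/
def bary {d : ℕ} (K : Finset (E d)) (z x : E d) : ℝ :=
  if h : AffineIndependent ℝ (fun p : K => (p : E d)) ∧
      affineSpan ℝ (Set.range (fun p : K => (p : E d))) = ⊤ ∧ z ∈ K then
    (AffineBasis.mk (fun p : K => (p : E d)) h.1 h.2.1).coord ⟨z, h.2.2⟩ x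
  else 0

open Classical in
/-- Two simplices of `S` that share a facet containing the vertex `z`. -/
def FacetAdj {d : ℕ} (S : Finset (Finset (E d))) (z : E d) (K L : Finset (E d)) : Prop :=
  K ∈ S ∧ L ∈ S ∧ z ∈ K ∧ z ∈ L ∧ (K ∩ L).card = d

open Classical in
/-- The patch `ω` of simplices around the vertex `z` of `K ∈ S`: all simplices of `S` that can be
reached from `K` through facets containing `z`. -/
def patch {d : ℕ} (S : Finset (Finset (E d))) (K : Finset (E d)) (z : E d) :
    Finset (Finset (E d)) :=
  S.filter (fun L => Relation.ReflTransGen (FacetAdj S z) K L)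

open Classical in
/-- The nodes (degrees of freedom) of the space of functions that are continuous on the open set
`meshDomain S` and affine on every `K ∈ S`. A node is a vertex `z` together with its patch. The
patch consists of all simplices of `S` that contain `z`, except where the open set `meshDomain S`
is pinched at `z`: there it falls, near `z`, into several parts, continuity on the open set does
not couple the values at `z` that are taken from different parts, and each part has its own
degree of freedom. -/
def nodes {d : ℕ} (S : Finset (Finset (E d))) : Finset (E d × Finset (Finset (E d))) :=
  S.biUnion (fun K => K.image (fun z => (z, patch S K z)))

open Classical in
/-- The nodal basis function of the node `(z, C)`: on the simplices of the patch `C` it is the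
barycentric coordinate of `z`, so it takes the value `1` at `z` and `0` at the other vertices, and
it vanishes off the patch. -/
def hat {d : ℕ} (j : E d × Finset (Finset (E d))) (x : E d) : ℝ :=
  if h : ∃ K ∈ j.2, x ∈ cell K then bary h.choose j.1 x else 0

open Classical in
/-- The nodes of `S` whose vertex does not lie in `D`. For `D = ∅` these are all nodes; for
`D = ∂Ω ∩ ∂Ω_h` they are the degrees of freedom that remain when the finite element functions are
required to vanish on `∂Ω ∩ ∂Ω_h`. -/
def freeNodes {d : ℕ} (S : Finset (Finset (E d))) (D : Set (E d)) :
    Finset (E d × Finset (Finset (E d))) :=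
  (nodes S).filter (fun j => j.1 ∉ D)

/-! ### The projected gradient stabilization -/

/-- The coefficient `g_j(w) = ∫ w φ_j / ∫ φ_j`, with integrals over the mesh domain. -/
def coeff {d : ℕ} (S : Finset (Finset (E d))) (w : E d → E d)
    (j : E d × Finset (Finset (E d))) : E d :=
  (∫ x in meshDomain S, hat j x)⁻¹ • ∫ x in meshDomain S, hat j x • w x

/-- The lumped-mass projection `P w = ∑_j g_j(w) φ_j`, the sum being over the nodes off `D`. -/
def lumpedProj {d : ℕ} (S : Finset (Finset (E d))) (D : Set (E d)) (w : E d → E d) :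
    E d → E d :=
  fun x => ∑ j ∈ freeNodes S D, hat j x • coeff S w j

/-- The stabilization form `s(u,v) = ∫_{Ω_h} (∇u - P ∇u) · ∇v`. -/
def stab {d : ℕ} (S : Finset (Finset (E d))) (D : Set (E d)) (u v : E d → ℝ) : ℝ :=
  ∫ x in meshDomain S,
    inner ℝ (weakGrad (meshDomain S) u x -
      lumpedProj S D (weakGrad (meshDomain S) u) x) (weakGrad (meshDomain S) v x)

end PG

end

namespace PG

open scoped ENNReal

/-! ### A Poincaré inequality for weak gradients on convex sets -/

/-! Almost everywhere on the mesh domain the nodal functions are nonnegative and sum to 1. With `m_j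
= ∫ φ_j` and `w = ∇u`, the projection term is `∑ m_j⁻¹ ⟨∫ φ_j w, ∫ φ_j ∇v⟩`, a sum over weighted
means. Continuity is therefore Cauchy–Schwarz with constant 2
(`abs_integral_inner_sub_meanProj_le`). It needs only `∑ φ_j ≤ 1`, so nodes may be dropped.

For `u = v` and the full family, the form is the sum of the `φ_j`-weighted variances of `w`. A
weighted mean minimizes the weighted square deviation, so each variance is at most `∫ φ_j ‖w -
c_j‖²` for any constant `c_j` (`integral_inner_sub_meanProj_self_le`). A Poincaré inequality on the
patch of each node gives the factor `h²` (`IsMesh.exists_sum_lintegral_patch_le`), and summation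
costs `d + 1`, the number of patches containing a given simplex (`sum_nodes_sum_eq`).

A patch need not be convex or star-shaped, so the Poincaré constant is obtained by chaining. The
quantity `sqDiff w A B` is controlled on convex sets by integrating along segments, then mollifying
and applying Fatou (`sqDiff_le_of_isWeakGrad`). It obeys a triangle inequality through an
intermediate set of comparable volume (`sqDiff_triangle`). Two simplices with a common facet are
linked by a ball around the facet's centroid, which lies in their union
(`IsSimplex.ball_centroid_subset_union`). Comparing volumes bounds the number of simplices in a
patch, hence the length of a chain. -/

lemma sq_lintegral_le_lintegral_sq {α : Type*} [MeasurableSpace α] (ν : Measure α)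
    [IsProbabilityMeasure ν] {f : α → ℝ≥0∞} (hf : AEMeasurable f ν) :
    (∫⁻ a, f a ∂ν) ^ 2 ≤ ∫⁻ a, f a ^ 2 ∂ν := by
  have h := ENNReal.lintegral_mul_le_Lp_mul_Lq ν Real.HolderConjugate.two_two hf
    (aemeasurable_const (b := (1 : ℝ≥0∞)))
  simp only [Pi.mul_apply, mul_one, ENNReal.one_rpow, lintegral_const, measure_univ] at h
  calc (∫⁻ a, f a ∂ν) ^ 2 ≤ ((∫⁻ a, f a ^ (2 : ℝ) ∂ν) ^ (1 / 2 : ℝ)) ^ 2 := by gcongr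
    _ = ∫⁻ a, f a ^ 2 ∂ν := by
      rw [← ENNReal.rpow_natCast, ← ENNReal.rpow_mul]
      simp

variable {d : ℕ}

/-- The Jacobian of the substitution is `s⁻ᵈ`, which stays below `2ᵈ` as long as `s` is away from
zero. -/
lemma lintegral_comp_smul_add {F : E d → ℝ≥0∞} (hF : Measurable F) {s : ℝ} (hs : 1 / 2 ≤ s)
    (c : E d) : ∫⁻ x, F (s • x + c) ≤ 2 ^ d * ∫⁻ x, F x := by
  have hs0 : (0 : ℝ) < s := by linarith
  have h1 : ∫⁻ x, F (s • x + c) = ∫⁻ z, F (z + c) ∂(Measure.map (fun x => s • x) volume) := by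
    exact (lintegral_map (f := fun z => F (z + c)) (hF.comp (measurable_add_const c))
      (measurable_const_smul s)).symm
  rw [h1, Measure.map_addHaar_smul _ hs0.ne', lintegral_smul_measure,
    lintegral_add_right_eq_self]
  simp only [finrank_euclideanSpace, Fintype.card_fin, smul_eq_mul]
  gcongr
  rw [abs_of_pos (by positivity), ← ENNReal.ofReal_ofNat, ← ENNReal.ofReal_pow (by norm_num)]
  apply ENNReal.ofReal_le_ofReal
  rw [← inv_pow]
  gcongr
  rw [inv_le_comm₀ hs0 (by norm_num)]
  linarith

/-- The mean square difference of `w` between two sets. -/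
noncomputable def sqDiff (w : E d → ℝ) (A B : Set (E d)) : ℝ≥0∞ :=
  ∫⁻ x in A, ∫⁻ y in B, ‖w x - w y‖ₑ ^ 2

/-- Fundamental theorem of calculus along the segment from `y` to `x`, then Cauchy–Schwarz in the
parameter. -/
lemma enorm_sub_sq_le_lintegral_segment {V : Set (E d)} (hV : Convex ℝ V) {h : ℝ}
    {f : E d → ℝ} {f' : E d → E d →L[ℝ] ℝ} (hf' : Continuous f')
    (hf : ∀ x ∈ V, HasFDerivAt f (f' x) x) {x y : E d} (hx : x ∈ V) (hy : y ∈ V)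
    (hxy : dist x y ≤ h) :
    ‖f x - f y‖ₑ ^ 2 ≤
      ENNReal.ofReal (h ^ 2) * ∫⁻ s in Set.Ioc (0 : ℝ) 1, ‖f' (s • x + (1 - s) • y)‖ₑ ^ 2 := by
  have hc : Continuous fun s : ℝ => f' (s • x + (1 - s) • y) := by fun_prop
  have hmem : ∀ s ∈ Set.Icc (0 : ℝ) 1, s • x + (1 - s) • y ∈ V := fun s hs =>
    hV hx hy hs.1 (by linarith [hs.2]) (by ring)
  have hder : ∀ s ∈ Set.uIcc (0 : ℝ) 1, HasDerivAt (fun s : ℝ => f (s • x + (1 - s) • y))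
      (f' (s • x + (1 - s) • y) (x - y)) s := by
    intro s hs
    rw [Set.uIcc_of_le zero_le_one] at hs
    refine (hf _ (hmem s hs)).comp_hasDerivAt s ?_
    have h1 := ((hasDerivAt_id s).smul_const x).add
      (((hasDerivAt_const s (1 : ℝ)).sub (hasDerivAt_id s)).smul_const y)
    refine (h1.congr_deriv ?_)
    simp [sub_eq_add_neg]
  have hint := intervalIntegral.integral_eq_sub_of_hasDerivAt hder
    ((hc.clm_apply continuous_const).intervalIntegrable _ _)
  have hval : f x - f y = ∫ s in (0 : ℝ)..1, f' (s • x + (1 - s) • y) (x - y) := by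
    rw [hint]; simp
  have : IsProbabilityMeasure (volume.restrict (Set.Ioc (0 : ℝ) 1)) := ⟨by simp⟩
  rw [hval, intervalIntegral.integral_of_le zero_le_one]
  have hxy' : ‖x - y‖ₑ ≤ ENNReal.ofReal h := by
    rw [← ofReal_norm, ← dist_eq_norm]
    exact ENNReal.ofReal_le_ofReal hxy
  have hh : 0 ≤ h := dist_nonneg.trans hxy
  calc ‖∫ s in Set.Ioc (0 : ℝ) 1, f' (s • x + (1 - s) • y) (x - y)‖ₑ ^ 2
      ≤ (∫⁻ s in Set.Ioc (0 : ℝ) 1, ENNReal.ofReal h * ‖f' (s • x + (1 - s) • y)‖ₑ) ^ 2 := by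
        gcongr
        refine (enorm_integral_le_lintegral_enorm _).trans ?_
        gcongr with s
        refine ((f' _).le_opENorm _).trans ?_
        rw [mul_comm]
        gcongr
    _ = ENNReal.ofReal (h ^ 2) *
        (∫⁻ s in Set.Ioc (0 : ℝ) 1, ‖f' (s • x + (1 - s) • y)‖ₑ) ^ 2 := by
        rw [lintegral_const_mul _ hc.enorm.measurable, mul_pow, ENNReal.ofReal_pow hh]
    _ ≤ _ := by
        gcongr
        exact sq_lintegral_le_lintegral_sq _ hc.enorm.measurable.aemeasurable

lemma lintegral_lintegral_segment_le {V : Set (E d)} (hV : Convex ℝ V) (hVm : MeasurableSet V)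
    {F : E d → ℝ≥0∞} (hF : Measurable F) {s : ℝ} (hs : s ∈ Set.Ioc (0 : ℝ) 1) :
    ∫⁻ x in V, ∫⁻ y in V, F (s • x + (1 - s) • y) ≤ 2 ^ d * volume V * ∫⁻ x in V, F x := by
  have hFV : Measurable (V.indicator F) := hF.indicator hVm
  have key : ∀ (t : ℝ), 1 / 2 ≤ t → t ≤ 1 → ∀ y ∈ V,
      ∫⁻ x in V, F (t • x + (1 - t) • y) ≤ 2 ^ d * ∫⁻ x in V, F x := by
    intro t ht ht1 y hy
    calc ∫⁻ x in V, F (t • x + (1 - t) • y)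
        = ∫⁻ x in V, V.indicator F (t • x + (1 - t) • y) := by
          refine setLIntegral_congr_fun hVm fun x hx => ?_
          rw [Set.indicator_of_mem (hV hx hy (by linarith) (by linarith) (by ring))]
      _ ≤ ∫⁻ x, V.indicator F (t • x + (1 - t) • y) := setLIntegral_le_lintegral _ _
      _ ≤ 2 ^ d * ∫⁻ x, V.indicator F x := lintegral_comp_smul_add hFV ht _
      _ = _ := by rw [lintegral_indicator hVm]
  have fin : ∀ {H : E d → ℝ≥0∞}, (∀ y ∈ V, H y ≤ 2 ^ d * ∫⁻ x in V, F x) →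
      ∫⁻ y in V, H y ≤ 2 ^ d * volume V * ∫⁻ x in V, F x := by
    intro H hH
    refine (setLIntegral_mono' hVm hH).trans (le_of_eq ?_)
    rw [setLIntegral_const]; ring
  -- One of `s` and `1 - s` is at least `1/2`. Integrating first in the variable with the larger
  -- weight keeps the Jacobian bounded.
  rcases le_total (1 / 2) s with h | h
  · rw [lintegral_lintegral_swap]
    · exact fin fun y hy => key s h hs.2 y hy
    · exact (hF.comp (by fun_prop)).aemeasurable
  · refine fin fun x hx => ?_
    have := key (1 - s) (by linarith) (by linarith [hs.1]) x hx
    simpa [add_comm] using this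

lemma sqDiff_le_of_hasFDerivAt {V : Set (E d)} (hV : Convex ℝ V) (hVm : MeasurableSet V)
    {h : ℝ} (hd : ∀ x ∈ V, ∀ y ∈ V, dist x y ≤ h)
    {f : E d → ℝ} {f' : E d → E d →L[ℝ] ℝ} (hf' : Continuous f')
    (hf : ∀ x ∈ V, HasFDerivAt f (f' x) x) :
    sqDiff f V V ≤ 2 ^ d * ENNReal.ofReal (h ^ 2) * volume V * ∫⁻ x in V, ‖f' x‖ₑ ^ 2 := by
  have hm : Measurable fun x => ‖f' x‖ₑ ^ 2 := (hf'.enorm.measurable).pow_const 2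
  calc sqDiff f V V ≤ ∫⁻ x in V, ∫⁻ y in V, ENNReal.ofReal (h ^ 2) *
        ∫⁻ s in Set.Ioc (0 : ℝ) 1, ‖f' (s • x + (1 - s) • y)‖ₑ ^ 2 :=
        setLIntegral_mono' hVm fun x hx => setLIntegral_mono' hVm fun y hy =>
          enorm_sub_sq_le_lintegral_segment hV hf' hf hx hy (hd x hx y hy)
    _ = ENNReal.ofReal (h ^ 2) * ∫⁻ s in Set.Ioc (0 : ℝ) 1, ∫⁻ x in V, ∫⁻ y in V,
        ‖f' (s • x + (1 - s) • y)‖ₑ ^ 2 := by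
        have m3 : Measurable fun q : (E d × E d) × ℝ =>
            ‖f' (q.2 • q.1.1 + (1 - q.2) • q.1.2)‖ₑ ^ 2 := hm.comp (by fun_prop)
        have m3' : Measurable fun q : (E d × ℝ) × E d =>
            ‖f' (q.1.2 • q.1.1 + (1 - q.1.2) • q.2)‖ₑ ^ 2 := hm.comp (by fun_prop)
        have m2 := m3.lintegral_prod_right' (ν := volume.restrict (Set.Ioc (0 : ℝ) 1))
        have m2' := m3'.lintegral_prod_right' (ν := volume.restrict V)
        have m1 := m2.lintegral_prod_right' (ν := volume.restrict V)
        have e1 : ∀ x : E d, ∫⁻ y in V, ENNReal.ofReal (h ^ 2) *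
            ∫⁻ s in Set.Ioc (0 : ℝ) 1, ‖f' (s • x + (1 - s) • y)‖ₑ ^ 2 =
            ENNReal.ofReal (h ^ 2) * ∫⁻ s in Set.Ioc (0 : ℝ) 1, ∫⁻ y in V,
              ‖f' (s • x + (1 - s) • y)‖ₑ ^ 2 := by
          intro x
          rw [lintegral_const_mul' _ _ (by simp), lintegral_lintegral_swap]
          exact (hm.comp (by fun_prop)).aemeasurable
        simp_rw [e1]
        rw [lintegral_const_mul' _ _ (by simp), lintegral_lintegral_swap]
        exact m2'.aemeasurable
    _ ≤ ENNReal.ofReal (h ^ 2) * ∫⁻ s in Set.Ioc (0 : ℝ) 1,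
          2 ^ d * volume V * ∫⁻ x in V, ‖f' x‖ₑ ^ 2 := by
        gcongr ENNReal.ofReal (h ^ 2) * ?_
        exact setLIntegral_mono' measurableSet_Ioc fun s hs =>
          lintegral_lintegral_segment_le hV hVm hm hs
    _ = _ := by simp; ring

/-! ### Mollification and the passage to weak gradients -/

/-- Mollification does not increase the `L²` norm. -/
lemma lintegral_enorm_convolution_sq_le (φ : ContDiffBump (0 : E d)) {Γ : E d → E d}
    (hΓ : Measurable Γ) :
    ∫⁻ x, ‖∫ t, φ.normed volume t • Γ (x - t)‖ₑ ^ 2 ≤ ∫⁻ x, ‖Γ x‖ₑ ^ 2 := by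
  -- The mollifier is a probability density, so the bound is Jensen's inequality followed by
  -- translation invariance.
  set ν : Measure (E d) := volume.withDensity fun t => ‖φ.normed volume t‖ₑ with hν
  have hφm : Measurable fun t => ‖φ.normed volume t‖ₑ :=
    (φ.continuous_normed (μ := (volume : Measure (E d)))).enorm.measurable
  have hprob : IsProbabilityMeasure ν := by
    constructor
    rw [hν, withDensity_apply _ MeasurableSet.univ, Measure.restrict_univ]
    have h1 := ofReal_integral_eq_lintegral_ofReal (φ.integrable_normed (μ := volume))
      (Filter.Eventually.of_forall fun x => φ.nonneg_normed (μ := volume) x)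
    rw [φ.integral_normed] at h1
    simp only [ENNReal.ofReal_one] at h1
    rw [h1]
    refine lintegral_congr fun x => ?_
    rw [Real.enorm_eq_ofReal (φ.nonneg_normed x)]
  calc ∫⁻ x, ‖∫ t, φ.normed volume t • Γ (x - t)‖ₑ ^ 2
      ≤ ∫⁻ x, (∫⁻ t, ‖Γ (x - t)‖ₑ ∂ν) ^ 2 := by
        gcongr with x
        refine (enorm_integral_le_lintegral_enorm _).trans (le_of_eq ?_)
        rw [hν, lintegral_withDensity_eq_lintegral_mul _ hφm (by fun_prop)]
        simp [enorm_smul]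
    _ ≤ ∫⁻ x, ∫⁻ t, ‖Γ (x - t)‖ₑ ^ 2 ∂ν := by
        gcongr with x
        exact sq_lintegral_le_lintegral_sq ν (by fun_prop)
    _ = ∫⁻ t, (∫⁻ x, ‖Γ (x - t)‖ₑ ^ 2) ∂ν := by
        refine lintegral_lintegral_swap ?_
        exact ((hΓ.comp (measurable_fst.sub measurable_snd)).enorm.pow_const 2).aemeasurable
    _ = _ := by
        have : ∀ t, ∫⁻ x, ‖Γ (x - t)‖ₑ ^ 2 = ∫⁻ x, ‖Γ x‖ₑ ^ 2 := fun t =>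
          lintegral_sub_right_eq_self (fun x => ‖Γ x‖ₑ ^ 2) t
        rw [lintegral_congr this, lintegral_const, measure_univ, mul_one]

/-- The mollification of `w 1_V`. -/
noncomputable def mollify (φ : ContDiffBump (0 : E d)) (V : Set (E d)) (w : E d → ℝ) : E d → ℝ :=
  convolution (V.indicator w) (φ.normed volume) (ContinuousLinearMap.lsmul ℝ ℝ).flip volume

lemma contDiff_mollify (φ : ContDiffBump (0 : E d)) {V : Set (E d)} {w : E d → ℝ}
    (hw : Integrable (V.indicator w)) : ContDiff ℝ 1 (mollify φ V w) :=
  φ.hasCompactSupport_normed.contDiff_convolution_right _ hw.locallyIntegrable φ.contDiff_normed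

/-- The derivative falls on the kernel, and `t ↦ η (x - t)` is an admissible test function because
its support lies in the ball contained in `V`. The sign from the chain rule cancels the sign in the
definition of the weak gradient. -/
lemma fderiv_mollify_apply (φ : ContDiffBump (0 : E d)) {V : Set (E d)} (hV : MeasurableSet V)
    {w : E d → ℝ} {G : E d → E d} (hw : Integrable (V.indicator w))
    (hG : Integrable (V.indicator G)) (hwG : IsWeakGrad V w G) {x : E d}
    (hx : Metric.closedBall x φ.rOut ⊆ V) (i : Fin d) :
    fderiv ℝ (mollify φ V w) x (EuclideanSpace.single i 1) =
      (∫ t, φ.normed volume t • V.indicator G (x - t)) i := by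
  set η := φ.normed (volume : Measure (E d)) with hη
  have hηs : ContDiff ℝ ∞ η := φ.contDiff_normed
  have hηc : HasCompactSupport η := φ.hasCompactSupport_normed
  have hd : fderiv ℝ (mollify φ V w) x (EuclideanSpace.single i 1) =
      ∫ t in V, w t * fderiv ℝ η (x - t) (EuclideanSpace.single i 1) := by
    rw [mollify, (hηc.hasFDerivAt_convolution_right _ hw.locallyIntegrable
      (hηs.of_le (by simp)) x).fderiv, convolution_precompR_apply _ hw.locallyIntegrable
      (hηc.fderiv ℝ) (hηs.continuous_fderiv (by simp)), convolution_def, ← integral_indicator hV]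
    refine integral_congr_ae (Filter.Eventually.of_forall fun t => ?_)
    by_cases ht : t ∈ V <;> simp [ht, mul_comm]
  have hφd : ∀ t, fderiv ℝ (fun t => η (x - t)) t (EuclideanSpace.single i 1) =
      - fderiv ℝ η (x - t) (EuclideanSpace.single i 1) := by
    intro t
    have h1 : HasFDerivAt (fun t => η (x - t))
        ((fderiv ℝ η (x - t)).comp (-ContinuousLinearMap.id ℝ (E d))) t :=
      ((hηs.differentiable (by simp)) (x - t)).hasFDerivAt.comp t
        ((hasFDerivAt_id t).const_sub x)
    rw [h1.fderiv]
    simp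
  have hts : tsupport (fun t => η (x - t)) ⊆ Metric.closedBall x φ.rOut := by
    refine closure_minimal ?_ Metric.isClosed_closedBall
    intro t ht
    have : x - t ∈ tsupport η := subset_tsupport _ ht
    rw [hη, φ.tsupport_normed_eq] at this
    simpa [dist_eq_norm, norm_sub_rev] using this
  have hweak := hwG (fun t => η (x - t)) (hηs.comp (contDiff_const.sub contDiff_id))
    ((isCompact_closedBall x φ.rOut).of_isClosed_subset (isClosed_tsupport _) hts) (hts.trans hx) i
  simp only [hφd, mul_neg, integral_neg, neg_inj] at hweak
  have hint : Integrable fun t => η t • V.indicator G (x - t) :=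
    hηc.convolutionExists_left (ContinuousLinearMap.lsmul ℝ ℝ) hηs.continuous
      hG.locallyIntegrable x
  have h2 := (EuclideanSpace.proj (𝕜 := ℝ) i : E d →L[ℝ] ℝ).integral_comp_comm hint
  rw [hd, hweak]
  refine Eq.trans ?_ h2
  rw [← integral_sub_left_eq_self _ volume x, ← integral_indicator hV]
  refine integral_congr_ae (Filter.Eventually.of_forall fun t => ?_)
  by_cases ht : t ∈ V <;> simp [ht, mul_comm]

lemma enorm_fderiv_mollify_le (φ : ContDiffBump (0 : E d)) {V : Set (E d)} (hV : MeasurableSet V)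
    {w : E d → ℝ} {G : E d → E d} (hw : Integrable (V.indicator w))
    (hG : Integrable (V.indicator G)) (hwG : IsWeakGrad V w G) {x : E d}
    (hx : Metric.closedBall x φ.rOut ⊆ V) :
    ‖fderiv ℝ (mollify φ V w) x‖ₑ ≤ ‖∫ t, φ.normed volume t • V.indicator G (x - t)‖ₑ := by
  have : fderiv ℝ (mollify φ V w) x =
      innerSL ℝ (∫ t, φ.normed volume t • V.indicator G (x - t)) := by
    ext v
    have hv : v = ∑ i, v i • EuclideanSpace.single i (1 : ℝ) := by
      ext j; simp [Finset.sum_apply, Pi.single_apply]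
    rw [hv, map_sum, map_sum]
    refine Finset.sum_congr rfl fun i _ => ?_
    rw [map_smul, map_smul, fderiv_mollify_apply φ hV hw hG hwG hx i]
    simp [EuclideanSpace.inner_single_right]
  rw [this, ← ofReal_norm, innerSL_apply_norm, ofReal_norm]

lemma IsWeakGrad.mono {U V : Set (E d)} {u : E d → ℝ} {G : E d → E d} (h : IsWeakGrad U u G)
    (hVU : V ⊆ U) : IsWeakGrad V u G := by
  intro φ hφ hc hs i
  have hz : ∀ x, x ∉ V → φ x = 0 := fun x hx => image_eq_zero_of_notMem_tsupport fun h => hx (hs h)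
  have hz' : ∀ x, x ∉ V → fderiv ℝ φ x = 0 := fun x hx =>
    image_eq_zero_of_notMem_tsupport fun h => hx (hs (tsupport_fderiv_subset ℝ h))
  have h1 := h φ hφ hc (hs.trans hVU) i
  rw [setIntegral_eq_integral_of_forall_compl_eq_zero fun x hx => by simp [hz' x (mt (@hVU x) hx)],
    setIntegral_eq_integral_of_forall_compl_eq_zero fun x hx => by
      simp [hz x (mt (@hVU x) hx)]] at h1
  rwa [setIntegral_eq_integral_of_forall_compl_eq_zero fun x hx => by simp [hz' x hx],
    setIntegral_eq_integral_of_forall_compl_eq_zero fun x hx => by simp [hz x hx]]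

/-- The points at distance at least `r` from the complement of a convex set form a convex set. -/
lemma convex_compl_thickening_compl {V : Set (E d)} (hV : Convex ℝ V) (r : ℝ) :
    Convex ℝ (Metric.thickening r Vᶜ)ᶜ := by
  -- In this form convexity is inherited from `V` one translation vector `v` at a time.
  have hiff : ∀ x, x ∈ (Metric.thickening r Vᶜ)ᶜ ↔ ∀ v : E d, ‖v‖ < r → x + v ∈ V := by
    intro x
    rw [Set.mem_compl_iff, Metric.mem_thickening_iff]
    push Not
    constructor
    · intro h v hv
      by_contra hc
      have := h _ hc
      simp at this
      linarith
    · intro h z hz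
      by_contra! hc
      refine hz ?_
      have := h (z - x) (by rwa [← dist_eq_norm, dist_comm])
      simpa using this
  intro x hx y hy a b ha hb hab
  rw [hiff] at hx hy ⊢
  intro v hv
  have : a • x + b • y + v = a • (x + v) + b • (y + v) := by
    rw [smul_add, smul_add, add_add_add_comm, ← add_smul, hab, one_smul]
  rw [this]
  exact hV (hx v hv) (hy v hv) ha hb hab

/-- Fatou's lemma, once in each variable, applied to the integrands cut off to `W n ×ˢ W n`; the
cutoff disappears pointwise in the limit. -/
lemma sqDiff_le_of_ae_tendsto {V : Set (E d)} (hVm : MeasurableSet V) {w : E d → ℝ}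
    {f : ℕ → E d → ℝ} (hfc : ∀ n, Continuous (f n)) {W : ℕ → Set (E d)}
    (hWm : ∀ n, MeasurableSet (W n)) (hWev : ∀ x ∈ V, ∀ᶠ n in Filter.atTop, x ∈ W n)
    (hconv : ∀ᵐ x, x ∈ V → Filter.Tendsto (fun n => f n x) Filter.atTop (nhds (w x)))
    {C : ℝ≥0∞} (hbound : ∀ n, sqDiff (f n) (W n) (W n) ≤ C) : sqDiff w V V ≤ C := by
  let F : ℕ → E d → E d → ℝ≥0∞ := fun n x y =>
    (W n).indicator (fun x => (W n).indicator (fun y => ‖f n x - f n y‖ₑ ^ 2) y) x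
  have hFm : ∀ n, Measurable fun q : E d × E d => F n q.1 q.2 := by
    intro n
    have : (fun q : E d × E d => F n q.1 q.2) = (W n ×ˢ W n).indicator
        fun q => ‖f n q.1 - f n q.2‖ₑ ^ 2 := by
      ext q
      by_cases h1 : q.1 ∈ W n <;> by_cases h2 : q.2 ∈ W n <;> simp [F, Set.indicator, h1, h2]
    rw [this]
    have hc := hfc n
    exact Measurable.indicator (by fun_prop) ((hWm n).prod (hWm n))
  have hFint : ∀ n, ∫⁻ x in V, ∫⁻ y in V, F n x y ≤ sqDiff (f n) (W n) (W n) := by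
    intro n
    have e1 : ∀ x, ∫⁻ y in V, F n x y ≤
        (W n).indicator (fun x => ∫⁻ y in W n, ‖f n x - f n y‖ₑ ^ 2) x := by
      intro x
      by_cases hx : x ∈ W n
      · simp only [F, Set.indicator_of_mem hx]
        rw [← lintegral_indicator (hWm n)]
        exact setLIntegral_le_lintegral _ _
      · simp [F, hx]
    refine (lintegral_mono e1).trans ((setLIntegral_le_lintegral _ _).trans ?_)
    rw [lintegral_indicator (hWm n)]
    rfl
  have hlim : ∀ᵐ x ∂volume.restrict V, ∀ᵐ y ∂volume.restrict V,
      ‖w x - w y‖ₑ ^ 2 ≤ Filter.liminf (fun n => F n x y) Filter.atTop := by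
    have hae : ∀ᵐ x ∂volume.restrict V,
        x ∈ V ∧ Filter.Tendsto (fun n => f n x) Filter.atTop (nhds (w x)) := by
      rw [ae_restrict_iff' hVm]
      filter_upwards [hconv] with x hx hxV using ⟨hxV, hx hxV⟩
    filter_upwards [hae] with x hx
    filter_upwards [hae] with y hy
    refine le_of_eq (Filter.Tendsto.liminf_eq ?_).symm
    have ht : Filter.Tendsto (fun n => ‖f n x - f n y‖ₑ ^ 2) Filter.atTop
        (nhds (‖w x - w y‖ₑ ^ 2)) := by
      have hc : Continuous fun z : ℝ => ‖z‖ₑ ^ 2 := by fun_prop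
      exact (hc.tendsto _).comp (hx.2.sub hy.2)
    refine ht.congr' ?_
    filter_upwards [hWev x hx.1, hWev y hy.1] with n h1 h2
    simp [F, h1, h2]
  calc sqDiff w V V ≤ ∫⁻ x in V, Filter.liminf (fun n => ∫⁻ y in V, F n x y) Filter.atTop := by
        refine lintegral_mono_ae ?_
        filter_upwards [hlim] with x hx
        exact (lintegral_mono_ae hx).trans
          (lintegral_liminf_le fun n => (hFm n).comp measurable_prodMk_left)
    _ ≤ Filter.liminf (fun n => ∫⁻ x in V, ∫⁻ y in V, F n x y) Filter.atTop :=
        lintegral_liminf_le fun n => (hFm n).lintegral_prod_right'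
    _ ≤ _ := by
        refine Filter.liminf_le_of_frequently_le' (Filter.Frequently.of_forall fun n => ?_)
        exact (hFint n).trans (hbound n)

/-- **Poincaré inequality** on a bounded convex open set, for weak gradients. -/
theorem sqDiff_le_of_isWeakGrad {V : Set (E d)} (hVo : IsOpen V) (hV : Convex ℝ V) {h : ℝ}
    (hd : ∀ x ∈ V, ∀ y ∈ V, dist x y ≤ h) {w : E d → ℝ} {G : E d → E d}
    (hGm : Measurable G) (hw : MemLp w 2 (volume.restrict V))
    (hG : MemLp G 2 (volume.restrict V)) (hwG : IsWeakGrad V w G) :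
    sqDiff w V V ≤ 2 ^ d * ENNReal.ofReal (h ^ 2) * volume V * ∫⁻ x in V, ‖G x‖ₑ ^ 2 := by
  have hVm := hVo.measurableSet
  have hVb : Bornology.IsBounded V := Metric.isBounded_iff.2 ⟨h, fun x hx y hy => hd x hx y hy⟩
  have : IsFiniteMeasure (volume.restrict V) := ⟨by simpa using hVb.measure_lt_top⟩
  have hWi : Integrable (V.indicator w) :=
    (integrable_indicator_iff hVm).2 (hw.integrable (by norm_num))
  have hΓi : Integrable (V.indicator G) :=
    (integrable_indicator_iff hVm).2 (hG.integrable (by norm_num))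
  -- The bounded ratio of the radii is what almost everywhere convergence of the mollifications
  -- requires.
  obtain ⟨φ, hφ, hφK⟩ : ∃ φ : ℕ → ContDiffBump (0 : E d),
      Filter.Tendsto (fun n => (φ n).rOut) Filter.atTop (nhds 0) ∧
      ∀ n, (φ n).rOut ≤ 2 * (φ n).rIn :=
    ⟨fun n => ⟨1 / (n + 1) / 2, 1 / (n + 1), by positivity, half_lt_self (by positivity)⟩,
      tendsto_one_div_add_atTop_nhds_zero_nat, fun n => by simp only; linarith⟩
  obtain ⟨f, hf⟩ : ∃ f : ℕ → E d → ℝ, ∀ n, f n = mollify (φ n) V w := ⟨_, fun _ => rfl⟩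
  have hfc : ∀ n, ContDiff ℝ 1 (f n) := fun n => by
    rw [hf]; exact contDiff_mollify (φ n) hWi
  have hconv : ∀ᵐ x, x ∈ V → Filter.Tendsto (fun n => f n x) Filter.atTop (nhds (w x)) := by
    have := ContDiffBump.ae_convolution_tendsto_right_of_locallyIntegrable (μ := volume) (K := 2)
      hφ (Filter.Eventually.of_forall hφK) hWi.locallyIntegrable
    filter_upwards [this] with x hx hxV
    rw [Set.indicator_of_mem hxV] at hx
    refine hx.congr fun n => ?_
    rw [← convolution_flip, hf, mollify]
  -- The factor 2 leaves room for the closed ball of radius `rOut` around each point of `W n` to lie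
  -- in `V`.
  obtain ⟨W, hW⟩ : ∃ W : ℕ → Set (E d), ∀ n, W n = (Metric.thickening (2 * (φ n).rOut) Vᶜ)ᶜ :=
    ⟨_, fun _ => rfl⟩
  have hWm : ∀ n, MeasurableSet (W n) := fun n => by
    rw [hW]; exact Metric.isOpen_thickening.measurableSet.compl
  have hWball : ∀ n, ∀ x ∈ W n, Metric.closedBall x (φ n).rOut ⊆ V := by
    intro n x hx z hz
    by_contra hc
    rw [hW] at hx
    refine hx (Metric.mem_thickening_iff.2 ⟨z, hc, ?_⟩)
    rw [dist_comm]
    have := (φ n).rOut_pos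
    have := Metric.mem_closedBall.1 hz
    linarith
  have hWV : ∀ n, W n ⊆ V := fun n x hx =>
    hWball n x hx (Metric.mem_closedBall_self (φ n).rOut_pos.le)
  have hWev : ∀ x ∈ V, ∀ᶠ n in Filter.atTop, x ∈ W n := by
    intro x hx
    obtain ⟨ε, hε, hb⟩ := Metric.isOpen_iff.1 hVo x hx
    have h2 : Filter.Tendsto (fun n => 2 * (φ n).rOut) Filter.atTop (nhds 0) := by
      simpa using hφ.const_mul 2
    filter_upwards [h2.eventually (gt_mem_nhds hε)] with n hn
    rw [hW]
    intro hc
    obtain ⟨z, hz, hz'⟩ := Metric.mem_thickening_iff.1 hc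
    exact hz (hb (by rw [Metric.mem_ball, dist_comm]; exact hz'.trans hn))
  have hbound : ∀ n, sqDiff (f n) (W n) (W n) ≤
      2 ^ d * ENNReal.ofReal (h ^ 2) * volume V * ∫⁻ x in V, ‖G x‖ₑ ^ 2 := by
    intro n
    refine (sqDiff_le_of_hasFDerivAt (hW n ▸ convex_compl_thickening_compl hV _) (hWm n)
      (fun x hx y hy => hd x (hWV n hx) y (hWV n hy))
      ((hfc n).continuous_fderiv one_ne_zero)
      (fun x _ => ((hfc n).differentiable one_ne_zero x).hasFDerivAt)).trans ?_
    refine mul_le_mul' (by gcongr; exact hWV n) ?_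
    calc ∫⁻ x in W n, ‖fderiv ℝ (f n) x‖ₑ ^ 2
          ≤ ∫⁻ x in W n, ‖∫ t, (φ n).normed volume t • V.indicator G (x - t)‖ₑ ^ 2 := by
            refine setLIntegral_mono' (hWm n) fun x hx => ?_
            rw [hf]
            gcongr
            exact enorm_fderiv_mollify_le (φ n) hVm hWi hΓi hwG (hWball n x hx)
        _ ≤ ∫⁻ x, ‖V.indicator G x‖ₑ ^ 2 :=
            (setLIntegral_le_lintegral _ _).trans
              (lintegral_enorm_convolution_sq_le (φ n) (hGm.indicator hVm))
        _ = ∫⁻ x in V, ‖G x‖ₑ ^ 2 := by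
            rw [← lintegral_indicator hVm]
            refine lintegral_congr fun x => ?_
            by_cases hx : x ∈ V <;> simp [hx]
  exact sqDiff_le_of_ae_tendsto hVm (fun n => (hfc n).continuous) hWm hWev hconv hbound

end PG

namespace PG

/-! ### Weighted means with respect to a partition of unity -/

section PartitionOfUnity

variable {X F : Type*} [MeasurableSpace X] {μ : Measure X}
  [NormedAddCommGroup F] [InnerProductSpace ℝ F]
  {φ : X → ℝ} {w v : X → F}

lemma integrable_smul_of_bounded {H : Type*} [NormedAddCommGroup H] [NormedSpace ℝ H]
    {u : X → H} (hφm : AEStronglyMeasurable φ μ) (hφ : ∀ᵐ x ∂μ, 0 ≤ φ x ∧ φ x ≤ 1)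
    (hu : Integrable u μ) : Integrable (fun x => φ x • u x) μ := by
  refine hu.mono (hφm.smul hu.aestronglyMeasurable) ?_
  filter_upwards [hφ] with x hx
  rw [norm_smul, Real.norm_of_nonneg hx.1]
  exact mul_le_of_le_one_left (norm_nonneg _) hx.2

variable [IsFiniteMeasure μ]

lemma integral_mul_norm_sub_sq [CompleteSpace F] (hφm : AEStronglyMeasurable φ μ)
    (hφ : ∀ᵐ x ∂μ, 0 ≤ φ x ∧ φ x ≤ 1) (hw : MemLp w 2 μ) (c : F) :
    ∫ x, φ x * ‖w x - c‖ ^ 2 ∂μ = ∫ x, φ x * ‖w x‖ ^ 2 ∂μ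
      - 2 * inner ℝ (∫ x, φ x • w x ∂μ) c + (∫ x, φ x ∂μ) * ‖c‖ ^ 2 := by
  have i1 : Integrable (fun x => φ x * ‖w x‖ ^ 2) μ :=
    integrable_smul_of_bounded hφm hφ hw.integrable_norm_pow'
  have i2 : Integrable (fun x => φ x • w x) μ :=
    integrable_smul_of_bounded hφm hφ (hw.integrable (by norm_num))
  have i3 : Integrable φ μ := by
    simpa using integrable_smul_of_bounded hφm hφ (integrable_const (1 : ℝ))
  have e : ∀ x, φ x * ‖w x - c‖ ^ 2 =
      φ x * ‖w x‖ ^ 2 - 2 * inner ℝ c (φ x • w x) + φ x * ‖c‖ ^ 2 := by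
    intro x
    rw [norm_sub_sq_real, inner_smul_right, real_inner_comm]; ring
  simp_rw [e]
  have i4 : Integrable (fun x => inner ℝ c (φ x • w x)) μ := i2.const_inner c
  rw [integral_add (f := fun x => φ x * ‖w x‖ ^ 2 - 2 * inner ℝ c (φ x • w x))
    (i1.sub (i4.const_mul 2)) (i3.mul_const _), integral_sub i1 (i4.const_mul 2), integral_const_mul, integral_mul_const,
    integral_inner i2, real_inner_comm]

/-- The left side is the weighted variance. With `m = ∫ φ` and `b = ∫ φ w`, expanding the square and
using `⟨b, c⟩ ≤ ‖b‖ ‖c‖` leaves the nonnegative excess `m⁻¹ (m ‖c‖ - ‖b‖)²`. -/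
lemma integral_mul_norm_sq_sub_le [CompleteSpace F] (hφm : AEStronglyMeasurable φ μ)
    (hφ : ∀ᵐ x ∂μ, 0 ≤ φ x ∧ φ x ≤ 1) (hw : MemLp w 2 μ) (c : F) :
    ∫ x, φ x * ‖w x‖ ^ 2 ∂μ - (∫ x, φ x ∂μ)⁻¹ * ‖∫ x, φ x • w x ∂μ‖ ^ 2 ≤
      ∫ x, φ x * ‖w x - c‖ ^ 2 ∂μ := by
  rw [integral_mul_norm_sub_sq hφm hφ hw c]
  have i3 : Integrable φ μ := by
    simpa using integrable_smul_of_bounded hφm hφ (integrable_const (1 : ℝ))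
  have hm : 0 ≤ ∫ x, φ x ∂μ := integral_nonneg_of_ae (hφ.mono fun x hx => hx.1)
  set b := ∫ x, φ x • w x ∂μ with hb
  set m := ∫ x, φ x ∂μ with hm'
  have hin := real_inner_le_norm b c
  rcases hm.eq_or_lt with h0 | h0
  -- A weight of total mass zero vanishes almost everywhere, so `b = 0` and the convention `0⁻¹ = 0`
  -- is harmless.
  · have hz : φ =ᵐ[μ] 0 :=
      (integral_eq_zero_iff_of_nonneg_ae (hφ.mono fun x hx => hx.1) i3).1 h0.symm
    have hb0 : b = 0 := by
      rw [hb]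
      refine integral_eq_zero_of_ae ?_
      filter_upwards [hz] with x hx
      simp [hx]
    simp [hb0, ← h0]
  · have : 0 ≤ m⁻¹ * (m * ‖c‖ - ‖b‖) ^ 2 := by positivity
    have e : m⁻¹ * (m * ‖c‖ - ‖b‖) ^ 2 = m * ‖c‖ ^ 2 - 2 * (‖b‖ * ‖c‖) + m⁻¹ * ‖b‖ ^ 2 := by
      field_simp; ring
    linarith

/-- The difference of the two sides is the weighted square deviation from the weighted mean, hence
nonnegative. -/
lemma inv_mul_norm_integral_sq_le [CompleteSpace F] (hφm : AEStronglyMeasurable φ μ)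
    (hφ : ∀ᵐ x ∂μ, 0 ≤ φ x ∧ φ x ≤ 1) (hw : MemLp w 2 μ) :
    (∫ x, φ x ∂μ)⁻¹ * ‖∫ x, φ x • w x ∂μ‖ ^ 2 ≤ ∫ x, φ x * ‖w x‖ ^ 2 ∂μ := by
  have hm : 0 ≤ ∫ x, φ x ∂μ := integral_nonneg_of_ae (hφ.mono fun x hx => hx.1)
  have h := integral_mul_norm_sub_sq hφm hφ hw ((∫ x, φ x ∂μ)⁻¹ • ∫ x, φ x • w x ∂μ)
  have h0 : 0 ≤ ∫ x, φ x * ‖w x - (∫ x, φ x ∂μ)⁻¹ • ∫ x, φ x • w x ∂μ‖ ^ 2 ∂μ :=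
    integral_nonneg_of_ae (hφ.mono fun x hx => mul_nonneg hx.1 (sq_nonneg _))
  rw [inner_smul_right, real_inner_self_eq_norm_sq, norm_smul, Real.norm_of_nonneg (by positivity),
    mul_pow] at h
  rcases hm.eq_or_lt with h1 | h1
  · rw [← h1, inv_zero, zero_mul]
    exact integral_nonneg_of_ae (hφ.mono fun x hx => mul_nonneg hx.1 (sq_nonneg _))
  · have : (∫ x, φ x ∂μ) * ((∫ x, φ x ∂μ)⁻¹ ^ 2 * ‖∫ x, φ x • w x ∂μ‖ ^ 2) =
        (∫ x, φ x ∂μ)⁻¹ * ‖∫ x, φ x • w x ∂μ‖ ^ 2 := by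
      field_simp
    linarith

variable {ι : Type*} {J : Finset ι} {Φ : ι → X → ℝ}

/-- The projection onto the span of a partition of unity that is built from weighted means. -/
noncomputable def meanProj (μ : Measure X) (J : Finset ι) (Φ : ι → X → ℝ) (w : X → F) : X → F :=
  fun x => ∑ j ∈ J, Φ j x • ((∫ y, Φ j y ∂μ)⁻¹ • ∫ y, Φ j y • w y ∂μ)

lemma integrable_inner_meanProj (hΦm : ∀ j ∈ J, AEStronglyMeasurable (Φ j) μ)
    (hΦ : ∀ᵐ x ∂μ, ∀ j ∈ J, 0 ≤ Φ j x ∧ Φ j x ≤ 1) (w : X → F) (hv : MemLp v 2 μ) :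
    Integrable (fun x => inner ℝ (meanProj μ J Φ w x) (v x)) μ := by
  simp only [meanProj, sum_inner, real_inner_smul_left]
  refine integrable_finsetSum _ fun j hj => ?_
  exact integrable_smul_of_bounded (hΦm j hj) (hΦ.mono fun x hx => hx j hj)
    (((hv.integrable (by norm_num)).const_inner _).const_mul _)

lemma integral_inner_meanProj [CompleteSpace F] (hΦm : ∀ j ∈ J, AEStronglyMeasurable (Φ j) μ)
    (hΦ : ∀ᵐ x ∂μ, ∀ j ∈ J, 0 ≤ Φ j x ∧ Φ j x ≤ 1) (w : X → F) (hv : MemLp v 2 μ) :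
    ∫ x, inner ℝ (meanProj μ J Φ w x) (v x) ∂μ = ∑ j ∈ J, (∫ x, Φ j x ∂μ)⁻¹ *
      inner ℝ (∫ x, Φ j x • w x ∂μ) (∫ x, Φ j x • v x ∂μ) := by
  have hi : ∀ j ∈ J, Integrable (fun x => Φ j x • v x) μ := fun j hj =>
    integrable_smul_of_bounded (hΦm j hj) (hΦ.mono fun x hx => hx j hj)
      (hv.integrable (by norm_num))
  have e : ∀ x, inner ℝ (meanProj μ J Φ w x) (v x) = ∑ j ∈ J, (∫ x, Φ j x ∂μ)⁻¹ *
      inner ℝ (∫ x, Φ j x • w x ∂μ) (Φ j x • v x) := by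
    intro x
    simp only [meanProj, sum_inner, real_inner_smul_left, real_inner_smul_right]
    exact Finset.sum_congr rfl fun j _ => by ring
  simp_rw [e]
  rw [integral_finsetSum _ fun j hj => ((hi j hj).const_inner _).const_mul _]
  refine Finset.sum_congr rfl fun j hj => ?_
  rw [integral_const_mul, integral_inner (hi j hj)]

lemma sum_inv_mul_norm_integral_sq_le [CompleteSpace F] (hΦm : ∀ j ∈ J, AEStronglyMeasurable (Φ j) μ)
    (hΦ : ∀ᵐ x ∂μ, ∀ j ∈ J, 0 ≤ Φ j x ∧ Φ j x ≤ 1) (hsum : ∀ᵐ x ∂μ, ∑ j ∈ J, Φ j x ≤ 1)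
    (hw : MemLp w 2 μ) :
    ∑ j ∈ J, (∫ x, Φ j x ∂μ)⁻¹ * ‖∫ x, Φ j x • w x ∂μ‖ ^ 2 ≤ ∫ x, ‖w x‖ ^ 2 ∂μ := by
  have hi : ∀ j ∈ J, Integrable (fun x => Φ j x * ‖w x‖ ^ 2) μ := fun j hj =>
    integrable_smul_of_bounded (hΦm j hj) (hΦ.mono fun x hx => hx j hj) hw.integrable_norm_pow'
  calc _ ≤ ∑ j ∈ J, ∫ x, Φ j x * ‖w x‖ ^ 2 ∂μ := Finset.sum_le_sum fun j hj =>
        inv_mul_norm_integral_sq_le (hΦm j hj) (hΦ.mono fun x hx => hx j hj) hw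
    _ = ∫ x, ∑ j ∈ J, Φ j x * ‖w x‖ ^ 2 ∂μ := (integral_finsetSum _ hi).symm
    _ ≤ _ := by
      refine integral_mono_ae (integrable_finsetSum _ hi) hw.integrable_norm_pow' ?_
      filter_upwards [hsum] with x hx
      rw [← Finset.sum_mul]
      exact mul_le_of_le_one_left (sq_nonneg _) hx

/-- Both `⟨w, v⟩` and the projected term are bounded by the product of the `L²` norms: the first by
Cauchy–Schwarz in `L²`, the second by Cauchy–Schwarz for the sum over `j` with each `m_j⁻¹` split
into two square roots. -/
theorem abs_integral_inner_sub_meanProj_le [CompleteSpace F]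
    (hΦm : ∀ j ∈ J, AEStronglyMeasurable (Φ j) μ)
    (hΦ : ∀ᵐ x ∂μ, ∀ j ∈ J, 0 ≤ Φ j x ∧ Φ j x ≤ 1) (hsum : ∀ᵐ x ∂μ, ∑ j ∈ J, Φ j x ≤ 1)
    (hw : MemLp w 2 μ) (hv : MemLp v 2 μ) :
    |∫ x, inner ℝ (w x - meanProj μ J Φ w x) (v x) ∂μ| ≤
      2 * (√(∫ x, ‖w x‖ ^ 2 ∂μ) * √(∫ x, ‖v x‖ ^ 2 ∂μ)) := by
  have h1 : |∫ x, inner ℝ (w x) (v x) ∂μ| ≤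
      √(∫ x, ‖w x‖ ^ 2 ∂μ) * √(∫ x, ‖v x‖ ^ 2 ∂μ) := by
    have hL := abs_real_inner_le_norm (hw.toLp w) (hv.toLp v)
    have hn : ∀ {u : X → F} (hu : MemLp u 2 μ), ‖hu.toLp u‖ = √(∫ x, ‖u x‖ ^ 2 ∂μ) := by
      intro u hu
      rw [← Real.sqrt_sq (norm_nonneg _), ← real_inner_self_eq_norm_sq, L2.inner_def]
      congr 1
      refine integral_congr_ae ?_
      filter_upwards [hu.coeFn_toLp] with x hx
      rw [hx, real_inner_self_eq_norm_sq]
    rw [hn, hn, L2.inner_def] at hL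
    convert hL using 2
    refine integral_congr_ae ?_
    filter_upwards [hw.coeFn_toLp, hv.coeFn_toLp] with x hx hx'
    rw [hx, hx']
  have h2 : |∫ x, inner ℝ (meanProj μ J Φ w x) (v x) ∂μ| ≤
      √(∫ x, ‖w x‖ ^ 2 ∂μ) * √(∫ x, ‖v x‖ ^ 2 ∂μ) := by
    rw [integral_inner_meanProj hΦm hΦ w hv]
    have hm : ∀ j ∈ J, 0 ≤ ∫ x, Φ j x ∂μ := fun j hj =>
      integral_nonneg_of_ae (hΦ.mono fun x hx => (hx j hj).1)
    calc _ ≤ ∑ j ∈ J, (√(∫ x, Φ j x ∂μ)⁻¹ * ‖∫ x, Φ j x • w x ∂μ‖) *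
          (√(∫ x, Φ j x ∂μ)⁻¹ * ‖∫ x, Φ j x • v x ∂μ‖) := by
          refine (Finset.abs_sum_le_sum_abs _ _).trans (Finset.sum_le_sum fun j hj => ?_)
          rw [mul_mul_mul_comm, Real.mul_self_sqrt (inv_nonneg.2 (hm j hj)), abs_mul,
            abs_of_nonneg (inv_nonneg.2 (hm j hj))]
          gcongr
          · exact inv_nonneg.2 (hm j hj)
          · exact abs_real_inner_le_norm _ _
      _ ≤ √(∑ j ∈ J, (√(∫ x, Φ j x ∂μ)⁻¹ * ‖∫ x, Φ j x • w x ∂μ‖) ^ 2) *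
          √(∑ j ∈ J, (√(∫ x, Φ j x ∂μ)⁻¹ * ‖∫ x, Φ j x • v x ∂μ‖) ^ 2) :=
          Real.sum_mul_le_sqrt_mul_sqrt _ _ _
      _ ≤ _ := by
          have e : ∀ u : X → F, ∑ j ∈ J, (√(∫ x, Φ j x ∂μ)⁻¹ * ‖∫ x, Φ j x • u x ∂μ‖) ^ 2 =
              ∑ j ∈ J, (∫ x, Φ j x ∂μ)⁻¹ * ‖∫ x, Φ j x • u x ∂μ‖ ^ 2 := fun u =>
            Finset.sum_congr rfl fun j hj => by
              rw [mul_pow, Real.sq_sqrt (inv_nonneg.2 (hm j hj))]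
          rw [e, e]
          gcongr
          · exact sum_inv_mul_norm_integral_sq_le hΦm hΦ hsum hw
          · exact sum_inv_mul_norm_integral_sq_le hΦm hΦ hsum hv
  have hsub : ∫ x, inner ℝ (w x - meanProj μ J Φ w x) (v x) ∂μ =
      ∫ x, inner ℝ (w x) (v x) ∂μ - ∫ x, inner ℝ (meanProj μ J Φ w x) (v x) ∂μ := by
    simp_rw [inner_sub_left]
    have hwv : Integrable (fun x => inner ℝ (w x) (v x)) μ := by
      refine (L2.integrable_inner (𝕜 := ℝ) (hw.toLp w) (hv.toLp v)).congr ?_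
      filter_upwards [hw.coeFn_toLp, hv.coeFn_toLp] with x hx hx'
      rw [hx, hx']
    exact integral_sub hwv (integrable_inner_meanProj hΦm hΦ w hv)
  rw [hsub]
  have := abs_sub (∫ x, inner ℝ (w x) (v x) ∂μ) (∫ x, inner ℝ (meanProj μ J Φ w x) (v x) ∂μ)
  linarith

/-- Since the weights sum to exactly 1, `‖w‖²` can be distributed over the indices. What remains for
each `j` is a weighted variance, which does not exceed the deviation from an arbitrary `c j`. -/
theorem integral_inner_sub_meanProj_self_le [CompleteSpace F]
    (hΦm : ∀ j ∈ J, AEStronglyMeasurable (Φ j) μ)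
    (hΦ : ∀ᵐ x ∂μ, ∀ j ∈ J, 0 ≤ Φ j x ∧ Φ j x ≤ 1) (hsum : ∀ᵐ x ∂μ, ∑ j ∈ J, Φ j x = 1)
    (hw : MemLp w 2 μ) (c : ι → F) :
    ∫ x, inner ℝ (w x - meanProj μ J Φ w x) (w x) ∂μ ≤
      ∑ j ∈ J, ∫ x, Φ j x * ‖w x - c j‖ ^ 2 ∂μ := by
  have hi : ∀ j ∈ J, Integrable (fun x => Φ j x * ‖w x‖ ^ 2) μ := fun j hj =>
    integrable_smul_of_bounded (hΦm j hj) (hΦ.mono fun x hx => hx j hj) hw.integrable_norm_pow'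
  have hww : Integrable (fun x => inner ℝ (w x) (w x)) μ := by
    simpa only [real_inner_self_eq_norm_sq] using hw.integrable_norm_pow'
  have hsplit : ∫ x, inner ℝ (w x) (w x) ∂μ = ∑ j ∈ J, ∫ x, Φ j x * ‖w x‖ ^ 2 ∂μ := by
    rw [← integral_finsetSum _ hi]
    refine integral_congr_ae ?_
    filter_upwards [hsum] with x hx
    rw [← Finset.sum_mul, hx, one_mul, real_inner_self_eq_norm_sq]
  simp_rw [inner_sub_left]
  rw [integral_sub hww (integrable_inner_meanProj hΦm hΦ w hw), hsplit,
    integral_inner_meanProj hΦm hΦ w hw, ← Finset.sum_sub_distrib]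
  refine Finset.sum_le_sum fun j hj => ?_
  rw [real_inner_self_eq_norm_sq]
  exact integral_mul_norm_sq_sub_le (hΦm j hj) (hΦ.mono fun x hx => hx j hj) hw (c j)

end PartitionOfUnity

end PG

namespace PG

/-! ### Geometry of simplices -/

variable {d : ℕ}

/-- The finite set `K` is the vertex set of a nondegenerate `d`-simplex. -/
structure IsSimplex (K : Finset (E d)) : Prop where
  card_eq : K.card = d + 1
  affineIndependent : AffineIndependent ℝ (fun p : K => (p : E d))

namespace IsSimplex

variable {K L : Finset (E d)}

lemma affineSpan_eq_top (hK : IsSimplex K) :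
    affineSpan ℝ (Set.range (fun p : K => (p : E d))) = ⊤ := by
  rw [hK.affineIndependent.affineSpan_eq_top_iff_card_eq_finrank_add_one]
  simp [hK.card_eq]

/-- The vertices as an affine basis. -/
noncomputable def basis (hK : IsSimplex K) : AffineBasis K ℝ (E d) :=
  AffineBasis.mk (fun p : K => (p : E d)) hK.affineIndependent hK.affineSpan_eq_top

lemma basis_apply (hK : IsSimplex K) (p : K) : hK.basis p = p := rfl

lemma range_basis (hK : IsSimplex K) : Set.range hK.basis = (K : Set (E d)) := by
  ext x; simp [basis_apply]

lemma bary_eq (hK : IsSimplex K) {z : E d} (hz : z ∈ K) (x : E d) :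
    bary K z x = hK.basis.coord ⟨z, hz⟩ x := by
  rw [bary, dif_pos ⟨hK.affineIndependent, hK.affineSpan_eq_top, hz⟩]
  rfl

lemma mem_cell_iff (hK : IsSimplex K) {x : E d} : x ∈ cell K ↔ ∀ z ∈ K, 0 ≤ bary K z x := by
  rw [cell, ← hK.range_basis, hK.basis.convexHull_eq_nonneg_coord]
  simp only [Set.mem_ofPred_eq, Subtype.forall]
  exact forall₂_congr fun z hz => by rw [hK.bary_eq hz]

lemma mem_interior_cell_iff (hK : IsSimplex K) {x : E d} :
    x ∈ interior (cell K) ↔ ∀ z ∈ K, 0 < bary K z x := by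
  rw [cell, ← hK.range_basis, hK.basis.interior_convexHull]
  simp only [Set.mem_ofPred_eq, Subtype.forall]
  exact forall₂_congr fun z hz => by rw [hK.bary_eq hz]

lemma sum_bary (hK : IsSimplex K) (x : E d) : ∑ z ∈ K, bary K z x = 1 := by
  rw [← hK.basis.sum_coord_apply_eq_one x, ← Finset.sum_coe_sort]
  exact Finset.sum_congr rfl fun z _ => hK.bary_eq z.2 x

lemma bary_self (hK : IsSimplex K) {z : E d} (hz : z ∈ K) : bary K z z = 1 := by
  rw [hK.bary_eq hz]
  exact hK.basis.coord_apply_eq ⟨z, hz⟩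

lemma bary_of_ne (hK : IsSimplex K) {z y : E d} (hz : z ∈ K) (hy : y ∈ K) (hzy : z ≠ y) :
    bary K z y = 0 := by
  rw [hK.bary_eq hz]
  exact hK.basis.coord_apply_ne (j := ⟨y, hy⟩) (by simpa using hzy)

lemma bary_linear (hK : IsSimplex K) {z : E d} (hz : z ∈ K) :
    ∃ (A : E d →ₗ[ℝ] ℝ) (c : ℝ), ∀ x, bary K z x = A x + c := by
  refine ⟨(hK.basis.coord ⟨z, hz⟩).linear, hK.basis.coord ⟨z, hz⟩ 0, fun x => ?_⟩
  rw [hK.bary_eq hz, AffineMap.decomp (hK.basis.coord ⟨z, hz⟩)]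
  simp

lemma continuous_bary (hK : IsSimplex K) {z : E d} (hz : z ∈ K) : Continuous (bary K z) := by
  obtain ⟨A, c, h⟩ := hK.bary_linear hz
  rw [funext h]
  exact A.continuous_of_finiteDimensional.add continuous_const

lemma bary_le_one (hK : IsSimplex K) {z x : E d} (hz : z ∈ K) (hx : x ∈ cell K) :
    bary K z x ≤ 1 := by
  rw [← hK.sum_bary x]
  exact Finset.single_le_sum (fun y hy => hK.mem_cell_iff.1 hx y hy) hz

/-- An affine function with values in `[0, 1]` on a ball of radius `ρ` has linear part at most 1 on
vectors shorter than `ρ`. Testing with a vector of length `ρ / 2` gives the constant `2 / ρ`. -/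
lemma abs_bary_sub_le (hK : IsSimplex K) {c : E d} {ρ : ℝ} (hρ : 0 < ρ)
    (hb : Metric.ball c ρ ⊆ cell K) {z : E d} (hz : z ∈ K) (p q : E d) :
    |bary K z p - bary K z q| ≤ 2 / ρ * ‖p - q‖ := by
  obtain ⟨A, a, h⟩ := hK.bary_linear hz
  have hbd : ∀ v : E d, ‖v‖ < ρ → |A v| ≤ 1 := by
    intro v hv
    have h1 : c + v ∈ cell K := hb (by simpa using hv)
    have h2 : c ∈ cell K := hb (Metric.mem_ball_self hρ)
    have e : A v = bary K z (c + v) - bary K z c := by rw [h, h, map_add]; ring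
    rw [e, abs_le]
    have := hK.mem_cell_iff.1 h1 z hz
    have := hK.mem_cell_iff.1 h2 z hz
    have := hK.bary_le_one hz h1
    have := hK.bary_le_one hz h2
    constructor <;> linarith
  have e : bary K z p - bary K z q = A (p - q) := by rw [h, h, map_sub]; ring
  rw [e]
  rcases eq_or_ne (p - q) 0 with h0 | h0
  · simp [h0]
  have hn : 0 < ‖p - q‖ := norm_pos_iff.2 h0
  have h1 := hbd ((ρ / 2 / ‖p - q‖) • (p - q)) (by
    rw [norm_smul, Real.norm_of_nonneg (by positivity), div_mul_cancel₀ _ hn.ne']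
    linarith)
  rw [map_smul, smul_eq_mul, abs_mul, abs_of_pos (by positivity)] at h1
  calc |A (p - q)| = 2 / ρ * ‖p - q‖ * (ρ / 2 / ‖p - q‖ * |A (p - q)|) := by field_simp
    _ ≤ 2 / ρ * ‖p - q‖ * 1 := by gcongr
    _ = _ := mul_one _

lemma bary_eq_zero_of_mem_convexHull (hK : IsSimplex K) {z : E d} (hz : z ∈ K)
    {s : Set (E d)} (hs : s ⊆ K) (hzs : z ∉ s) {x : E d} (hx : x ∈ convexHull ℝ s) :
    bary K z x = 0 := by
  obtain ⟨A, c, h⟩ := hK.bary_linear hz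
  have hconv : Convex ℝ {x | bary K z x = 0} := by
    intro x hx y hy a b ha hb hab
    simp only [Set.mem_ofPred_eq, h, map_add, map_smul, smul_eq_mul] at hx hy ⊢
    have hx' : A x = -c := by linarith
    have hy' : A y = -c := by linarith
    rw [hx', hy']
    linear_combination (-c) * hab
  exact convexHull_min (fun y hy => hK.bary_of_ne hz (hs hy) (by rintro rfl; exact hzs hy))
    hconv hx

/-- By conformity a common point lies in the face spanned by the common vertices. That face misses a
vertex of `K`, whose coordinate vanishes there but is positive in the interior. -/
lemma notMem_cell_of_mem_interior (hK : IsSimplex K) (hL : IsSimplex L)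
    (hc : cell K ∩ cell L = convexHull ℝ ((K : Set (E d)) ∩ (L : Set (E d)))) (hne : K ≠ L)
    {x : E d} (hx : x ∈ interior (cell K)) : x ∉ cell L := by
  intro hxL
  obtain ⟨z, hzK, hzL⟩ : ∃ z ∈ K, z ∉ L := by
    by_contra! h
    exact hne (Finset.eq_of_subset_of_card_le h (by rw [hK.card_eq, hL.card_eq]))
  have h1 : x ∈ convexHull ℝ ((K : Set (E d)) ∩ (L : Set (E d))) :=
    hc ▸ ⟨interior_subset hx, hxL⟩
  have h2 := hK.bary_eq_zero_of_mem_convexHull hzK Set.inter_subset_left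
    (by simp [hzL]) h1
  exact (hK.mem_interior_cell_iff.1 hx z hzK).ne' h2

lemma bary_centroid (hK : IsSimplex K) {F : Finset (E d)} (hF : F ⊆ K) (hd : F.card = d)
    (hd0 : 0 < d) {z : E d} (hz : z ∈ K) [Decidable (z ∈ F)] :
    bary K z ((d : ℝ)⁻¹ • ∑ f ∈ F, f) = if z ∈ F then (d : ℝ)⁻¹ else 0 := by
  have hd' : (d : ℝ) ≠ 0 := by positivity
  obtain ⟨A, c, h⟩ := hK.bary_linear hz
  have e1 : bary K z ((d : ℝ)⁻¹ • ∑ f ∈ F, f) = (d : ℝ)⁻¹ * ∑ f ∈ F, bary K z f := by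
    simp only [h, map_smul, map_sum, smul_eq_mul, Finset.sum_add_distrib, Finset.sum_const, hd,
      nsmul_eq_mul]
    field_simp
  rw [e1]
  split_ifs with hzF
  · rw [Finset.sum_eq_single_of_mem z hzF fun y hy hyz => hK.bary_of_ne hz (hF hy) hyz.symm,
      hK.bary_self hz, mul_one]
  · rw [Finset.sum_eq_zero fun y hy => hK.bary_of_ne hz (hF hy) (by rintro rfl; exact hzF hy),
      mul_zero]

open Classical in
-- The coordinate equals `1 / d` at the centroid and has Lipschitz constant `2 / ρ`, which
-- determines the radius `ρ / (2 d)`.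
lemma bary_pos_near_centroid (hK : IsSimplex K) {F : Finset (E d)} (hF : F ⊆ K)
    (hd : F.card = d) (hd0 : 0 < d) {c : E d} {ρ : ℝ} (hρ : 0 < ρ)
    (hb : Metric.ball c ρ ⊆ cell K) {z : E d} (hz : z ∈ F) {p : E d}
    (hp : p ∈ Metric.ball ((d : ℝ)⁻¹ • ∑ f ∈ F, f) (ρ / (2 * d))) : 0 < bary K z p := by
  have hd' : (0 : ℝ) < d := by positivity
  have h1 := hK.abs_bary_sub_le hρ hb (hF hz) p ((d : ℝ)⁻¹ • ∑ f ∈ F, f)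
  rw [hK.bary_centroid hF hd hd0 (hF hz), if_pos hz] at h1
  rw [Metric.mem_ball, dist_eq_norm] at hp
  have h2 : 2 / ρ * ‖p - (d : ℝ)⁻¹ • ∑ f ∈ F, f‖ < (d : ℝ)⁻¹ := by
    calc _ < 2 / ρ * (ρ / (2 * d)) := by gcongr
      _ = _ := by field_simp
  have := (abs_le.1 h1).1
  linarith

open Classical in
/-- Around the centroid of a common facet, two simplices fill a ball. -/
lemma ball_centroid_subset_union (hK : IsSimplex K) (hL : IsSimplex L)
    (hc : cell K ∩ cell L = convexHull ℝ ((K : Set (E d)) ∩ (L : Set (E d))))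
    (hKL : (K ∩ L).card = d) (hd0 : 0 < d) {ρ : ℝ} (hρ : 0 < ρ) {x y : E d}
    (hx : Metric.ball x ρ ⊆ cell K) (hy : Metric.ball y ρ ⊆ cell L) :
    Metric.ball ((d : ℝ)⁻¹ • ∑ f ∈ K ∩ L, f) (ρ / (2 * d)) ⊆ cell K ∪ cell L := by
  set m := (d : ℝ)⁻¹ • ∑ f ∈ K ∩ L, f with hm
  have key : ∀ {K L : Finset (E d)} (hK : IsSimplex K) (hKL : (K ∩ L).card = d), ∃ a ∈ K, a ∉ L ∧
      ∀ z ∈ K, z ∉ K ∩ L → z = a := by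
    intro K L hK hKL
    have h1 : (K \ L).card = 1 := by
      have := Finset.card_sdiff_add_card_inter K L
      rw [hKL, hK.card_eq] at this
      omega
    obtain ⟨a, ha⟩ := Finset.card_eq_one.1 h1
    have haK : a ∈ K \ L := by simp [ha]
    rw [Finset.mem_sdiff] at haK
    refine ⟨a, haK.1, haK.2, fun z hz hzn => ?_⟩
    have : z ∈ K \ L := by simp at hzn ⊢; tauto
    simpa [ha] using this
  obtain ⟨a, haK, haL, ha⟩ := key hK hKL
  obtain ⟨b, hbL, hbK, hb⟩ := key hL (by rwa [Finset.inter_comm])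
  intro p hp
  have mem1 : ∀ q ∈ Metric.ball m (ρ / (2 * d)), 0 ≤ bary K a q → q ∈ cell K := by
    intro q hq haq
    refine hK.mem_cell_iff.2 fun z hz => ?_
    by_cases hzF : z ∈ K ∩ L
    · exact (hK.bary_pos_near_centroid Finset.inter_subset_left hKL hd0 hρ hx hzF hq).le
    · rwa [ha z hz hzF]
  have mem2 : ∀ q ∈ Metric.ball m (ρ / (2 * d)), 0 ≤ bary L b q → q ∈ cell L := by
    intro q hq hbq
    refine hL.mem_cell_iff.2 fun z hz => ?_
    by_cases hzF : z ∈ K ∩ L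
    · exact (hL.bary_pos_near_centroid Finset.inter_subset_right hKL hd0 hρ hy hzF hq).le
    · rwa [hb z hz (by rwa [Finset.inter_comm])]
  by_cases h1 : 0 ≤ bary K a p
  · exact Or.inl (mem1 p hp h1)
  by_cases h2 : 0 ≤ bary L b p
  · exact Or.inr (mem2 p hp h2)
  exfalso
  push Not at h1 h2
  obtain ⟨A, α, hA⟩ := hK.bary_linear haK
  obtain ⟨B, β, hB⟩ := hL.bary_linear hbL
  have hma : bary K a m = 0 := by
    rw [hm, hK.bary_centroid Finset.inter_subset_left hKL hd0 haK, if_neg (by simp [haL])]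
  have hmb : bary L b m = 0 := by
    rw [hm, hL.bary_centroid Finset.inter_subset_right hKL hd0 hbL, if_neg (by simp [hbK])]
  -- Reflect `p` in the centroid. The coordinates of the two opposite vertices vanish at `m` and are
  -- negative at `p`, so they are positive at `q`. Then `q` lies in both simplices, hence in their
  -- common face, where the coordinate of `a` is zero.
  set q := (2 : ℝ) • m - p with hq
  have hqball : q ∈ Metric.ball m (ρ / (2 * d)) := by
    rw [Metric.mem_ball, dist_eq_norm] at hp ⊢
    rwa [hq, two_smul, show m + m - p - m = -(p - m) by abel, norm_neg]
  have hqa : bary K a q = - bary K a p := by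
    rw [hA] at hma
    rw [hA, hA, hq, map_sub, map_smul, smul_eq_mul]; linarith
  have hqb : bary L b q = - bary L b p := by
    rw [hB] at hmb
    rw [hB, hB, hq, map_sub, map_smul, smul_eq_mul]; linarith
  have hqK := mem1 q hqball (by linarith)
  have hqL := mem2 q hqball (by linarith)
  have h3 : q ∈ convexHull ℝ ((K : Set (E d)) ∩ (L : Set (E d))) := hc ▸ ⟨hqK, hqL⟩
  have h4 := hK.bary_eq_zero_of_mem_convexHull haK Set.inter_subset_left (by simp [haL]) h3
  linarith

open Classical in
lemma centroid_mem_cell (hK : IsSimplex K) {F : Finset (E d)} (hF : F ⊆ K)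
    (hd : F.card = d) (hd0 : 0 < d) : (d : ℝ)⁻¹ • ∑ f ∈ F, f ∈ cell K := by
  refine hK.mem_cell_iff.2 fun z hz => ?_
  rw [hK.bary_centroid hF hd hd0 hz]
  split_ifs
  · positivity
  · exact le_rfl

end IsSimplex

lemma isCompact_cell (K : Finset (E d)) : IsCompact (cell K) :=
  K.finite_toSet.isCompact_convexHull (𝕜 := ℝ)

lemma convex_cell (K : Finset (E d)) : Convex ℝ (cell K) := convex_convexHull ℝ _

/-- A ball inside a convex set can be moved close to any point of the set, after shrinking. -/
lemma exists_ball_subset_near {V : Set (E d)} (hV : Convex ℝ V) {m c : E d} {ρ h t : ℝ}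
    (hm : m ∈ V) (hb : Metric.ball c ρ ⊆ V) (hcm : dist c m ≤ h) (ht : 0 < t) (ht1 : t ≤ 1) :
    ∃ c', Metric.ball c' (t * ρ) ⊆ V ∩ Metric.ball m (t * (h + ρ)) := by
  -- The homothety with centre `m` and ratio `t` maps the given ball to the required one.
  refine ⟨m + t • (c - m), fun p hp => ?_⟩
  rw [Metric.mem_ball, dist_eq_norm] at hp
  have hnorm : ‖t⁻¹ • (p - m) - (c - m)‖ < ρ := by
    have : t⁻¹ • (p - m) - (c - m) = t⁻¹ • (p - (m + t • (c - m))) := by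
      rw [← sub_sub, smul_sub t⁻¹ (p - m), smul_smul, inv_mul_cancel₀ ht.ne', one_smul]
    rw [this, norm_smul, Real.norm_of_nonneg (by positivity), inv_mul_lt_iff₀ ht]
    exact hp
  refine ⟨?_, ?_⟩
  · have h1 : m + t⁻¹ • (p - m) ∈ V := hb (by
      rw [Metric.mem_ball, dist_eq_norm, show m + t⁻¹ • (p - m) - c = t⁻¹ • (p - m) - (c - m) by abel]
      exact hnorm)
    have := hV.add_smul_sub_mem hm h1 ⟨ht.le, ht1⟩
    rwa [add_sub_cancel_left, smul_smul, mul_inv_cancel₀ ht.ne', one_smul, add_sub_cancel] at this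
  · rw [Metric.mem_ball, dist_eq_norm]
    rw [dist_eq_norm] at hcm
    calc ‖p - m‖ = ‖(p - (m + t • (c - m))) + t • (c - m)‖ := by congr 1; abel
      _ ≤ ‖p - (m + t • (c - m))‖ + t * ‖c - m‖ := by
        refine (norm_add_le _ _).trans ?_
        rw [norm_smul, Real.norm_of_nonneg ht.le]
      _ < t * ρ + t * h := add_lt_add_of_lt_of_le hp (mul_le_mul_of_nonneg_left hcm ht.le)
      _ = _ := by ring

end PG

namespace PG

open scoped ENNReal

/-! ### Mean square differences -/

variable {d : ℕ}

section SqDiff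

variable {w : E d → ℝ} {A B M : Set (E d)}

lemma measurable_enorm_sub_sq (hw : Measurable w) :
    Measurable fun q : E d × E d => ‖w q.1 - w q.2‖ₑ ^ 2 :=
  (((hw.comp measurable_fst).sub (hw.comp measurable_snd)).enorm).pow_const 2

lemma sqDiff_comm (hw : Measurable w) (A B : Set (E d)) : sqDiff w A B = sqDiff w B A := by
  rw [sqDiff, lintegral_lintegral_swap (measurable_enorm_sub_sq hw).aemeasurable]
  exact lintegral_congr fun y => lintegral_congr fun x => by rw [← enorm_neg, neg_sub]

lemma sqDiff_mono {A' B' : Set (E d)} (hA : A ⊆ A') (hB : B ⊆ B') :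
    sqDiff w A B ≤ sqDiff w A' B' :=
  lintegral_mono' (Measure.restrict_mono hA le_rfl) fun _ =>
    lintegral_mono' (Measure.restrict_mono hB le_rfl) fun _ => le_rfl

lemma enorm_sub_sq_le (a b c : ℝ) :
    ‖a - b‖ₑ ^ 2 ≤ 2 * ‖a - c‖ₑ ^ 2 + 2 * ‖c - b‖ₑ ^ 2 := by
  have e : ∀ z : ℝ, ‖z‖ₑ ^ 2 = ENNReal.ofReal (z ^ 2) := fun z => by
    rw [Real.enorm_eq_ofReal_abs, ← ENNReal.ofReal_pow (abs_nonneg _), sq_abs]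
  rw [e, e, e, ← ENNReal.ofReal_ofNat, ← ENNReal.ofReal_mul (by norm_num),
    ← ENNReal.ofReal_mul (by norm_num), ← ENNReal.ofReal_add (by positivity) (by positivity)]
  apply ENNReal.ofReal_le_ofReal
  nlinarith [sq_nonneg (a - c - (c - b))]

/-- Integrate the pointwise bound `|w x - w y|² ≤ 2 |w x - w z|² + 2 |w z - w y|²` over all
intermediate points `z ∈ M`. -/
lemma volume_mul_sqDiff_le (hw : Measurable w) (A B M : Set (E d)) :
    volume M * sqDiff w A B ≤
      2 * (volume B * sqDiff w A M + volume A * sqDiff w M B) := by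
  have hm := measurable_enorm_sub_sq hw
  have hmx : ∀ x, Measurable fun y => ‖w x - w y‖ₑ ^ 2 := fun x =>
    ((measurable_const.sub hw).enorm).pow_const 2
  have hmy : ∀ y, Measurable fun x => ‖w x - w y‖ₑ ^ 2 := fun y =>
    ((hw.sub measurable_const).enorm).pow_const 2
  have hI : Measurable fun x => ∫⁻ y in M, ‖w x - w y‖ₑ ^ 2 := hm.lintegral_prod_right'
  have hI' : Measurable fun y => ∫⁻ x in M, ‖w x - w y‖ₑ ^ 2 := hm.lintegral_prod_left'
  have hIB : Measurable fun x => ∫⁻ y in B, ‖w x - w y‖ₑ ^ 2 := hm.lintegral_prod_right'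
  have h1 : ∀ x y, volume M * ‖w x - w y‖ₑ ^ 2 ≤
      2 * (∫⁻ z in M, ‖w x - w z‖ₑ ^ 2) + 2 * ∫⁻ z in M, ‖w z - w y‖ₑ ^ 2 := by
    intro x y
    calc volume M * ‖w x - w y‖ₑ ^ 2 = ∫⁻ z in M, ‖w x - w y‖ₑ ^ 2 := by
          rw [setLIntegral_const, mul_comm]
      _ ≤ ∫⁻ z in M, (2 * ‖w x - w z‖ₑ ^ 2 + 2 * ‖w z - w y‖ₑ ^ 2) :=
          lintegral_mono fun z => enorm_sub_sq_le _ _ _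
      _ = _ := by
          rw [lintegral_add_left ((hmx x).const_mul 2), lintegral_const_mul _ (hmx x),
            lintegral_const_mul _ (hmy y)]
  have hswap : ∫⁻ y in B, ∫⁻ z in M, ‖w z - w y‖ₑ ^ 2 = sqDiff w M B := by
    exact lintegral_lintegral_swap
      (((hw.comp measurable_snd).sub (hw.comp measurable_fst)).enorm.pow_const 2).aemeasurable
  have h2 : ∀ x, volume M * ∫⁻ y in B, ‖w x - w y‖ₑ ^ 2 ≤
      2 * volume B * (∫⁻ z in M, ‖w x - w z‖ₑ ^ 2) + 2 * sqDiff w M B := by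
    intro x
    rw [← lintegral_const_mul _ (hmx x)]
    refine (lintegral_mono (h1 x)).trans (le_of_eq ?_)
    rw [lintegral_add_left measurable_const, setLIntegral_const, lintegral_const_mul _ hI', hswap]
    ring
  rw [sqDiff, ← lintegral_const_mul _ hIB]
  refine (lintegral_mono h2).trans (le_of_eq ?_)
  rw [lintegral_add_left (hI.const_mul _), lintegral_const_mul _ hI, setLIntegral_const]
  simp only [sqDiff]
  ring

lemma sqDiff_triangle (hw : Measurable w) {v : ℝ≥0∞} {k : ℕ} (hv0 : v ≠ 0) (hv : v ≠ ⊤)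
    (hA : volume A ≤ v) (hB : volume B ≤ v) (hM : volume M ≤ v) (hM' : v ≤ k * volume M) :
    sqDiff w A B ≤ 2 * k * (sqDiff w A M + sqDiff w M B) := by
  have hM0 : volume M ≠ 0 := by
    intro h
    rw [h, mul_zero] at hM'
    exact hv0 (le_antisymm hM' bot_le)
  have hMt : volume M ≠ ⊤ := ne_top_of_le_ne_top hv hM
  rw [← ENNReal.mul_le_mul_iff_right hM0 hMt]
  calc volume M * sqDiff w A B
      ≤ 2 * (volume B * sqDiff w A M + volume A * sqDiff w M B) := volume_mul_sqDiff_le hw A B M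
    _ ≤ 2 * (k * volume M * sqDiff w A M + k * volume M * sqDiff w M B) := by
        gcongr
        · exact hB.trans hM'
        · exact hA.trans hM'
    _ = _ := by ring

/-- The constant is the value of `w` at a point of `A` where the total square deviation is at most
its average over `A`. One constant thus serves all the `V i`. -/
lemma exists_sum_lintegral_sub_le (hw : Measurable w) {ι : Type*} (C : Finset ι)
    (V : ι → Set (E d)) (hA0 : volume A ≠ 0) (hA : volume A ≠ ⊤) :
    ∃ c : ℝ, volume A * ∑ i ∈ C, ∫⁻ x in V i, ‖w x - c‖ₑ ^ 2 ≤ ∑ i ∈ C, sqDiff w A (V i) := by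
  have hm : ∀ i, Measurable fun y => ∫⁻ x in V i, ‖w y - w x‖ₑ ^ 2 := fun i =>
    (measurable_enorm_sub_sq hw).lintegral_prod_right'
  obtain ⟨y, _, hy⟩ := exists_le_setLAverage hA0 hA
    (Finset.measurable_sum C fun i _ => hm i).aemeasurable
  refine ⟨w y, ?_⟩
  rw [setLAverage_eq] at hy
  have h2 : ∑ i ∈ C, ∫⁻ x in V i, ‖w x - w y‖ₑ ^ 2 =
      ∑ i ∈ C, ∫⁻ x in V i, ‖w y - w x‖ₑ ^ 2 := by
    exact Finset.sum_congr rfl fun i _ => lintegral_congr fun x => by rw [← enorm_neg, neg_sub]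
  rw [h2]
  calc _ ≤ volume A * ((∫⁻ a in A, ∑ i ∈ C, ∫⁻ x in V i, ‖w a - w x‖ₑ ^ 2) / volume A) := by
        gcongr
    _ = ∫⁻ a in A, ∑ i ∈ C, ∫⁻ x in V i, ‖w a - w x‖ₑ ^ 2 := ENNReal.mul_div_cancel hA0 hA
    _ = _ := lintegral_finsetSum C fun i _ => hm i

end SqDiff

/-! ### Poincaré inequality on vertex patches -/

/-- Finitely many conforming simplices of diameter at most `h` that contain balls of
radius `κ h`. -/
structure IsMesh (S : Finset (Finset (E d))) (h κ : ℝ) : Prop where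
  isSimplex : ∀ K ∈ S, IsSimplex K
  conforming : ∀ K ∈ S, ∀ L ∈ S,
    cell K ∩ cell L = convexHull ℝ ((K : Set (E d)) ∩ (L : Set (E d)))
  dist_le : ∀ K ∈ S, ∀ x ∈ cell K, ∀ y ∈ cell K, dist x y ≤ h
  exists_ball : ∀ K ∈ S, ∃ x, Metric.ball x (κ * h) ⊆ cell K

/-- A bound for the ratio of the volumes of a ball of radius `h` and a ball of radius
`κ² h / (4 d)`. -/
noncomputable def volRatio (d : ℕ) (κ : ℝ) : ℕ := ⌈((κ / (4 * d) * κ) ^ d)⁻¹⌉₊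

/-- The constant in the Poincaré inequality on vertex patches. -/
noncomputable def patchConst (d : ℕ) (κ : ℝ) : ℕ :=
  4 * 2 ^ d * volRatio d κ ^ 2 * (26 * volRatio d κ ^ 3) ^ volRatio d κ

lemma one_le_volRatio (hd : 0 < d) {κ : ℝ} (hκ : 0 < κ) : 1 ≤ volRatio d κ := by
  have : (0 : ℝ) < d := by positivity
  exact Nat.one_le_ceil_iff.2 (by positivity)

lemma volume_ball_le_volRatio_mul (hd : 0 < d) {κ h : ℝ} (hκ : 0 < κ) (hh : 0 < h) (c : E d) :
    volume (Metric.ball (0 : E d) h) ≤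
      volRatio d κ * volume (Metric.ball c (κ / (4 * d) * (κ * h))) := by
  have hd' : (0 : ℝ) < d := by positivity
  have : Nonempty (Fin d) := ⟨⟨0, hd⟩⟩
  rw [Measure.addHaar_ball volume (0 : E d) hh.le,
    Measure.addHaar_ball volume c (r := κ / (4 * d) * (κ * h)) (by positivity), ← mul_assoc]
  gcongr
  simp only [finrank_euclideanSpace, Fintype.card_fin]
  rw [← ENNReal.ofReal_natCast, ← ENNReal.ofReal_mul (by positivity)]
  apply ENNReal.ofReal_le_ofReal
  have h1 : ((κ / (4 * d) * κ) ^ d)⁻¹ ≤ (volRatio d κ : ℝ) := Nat.le_ceil _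
  calc h ^ d = ((κ / (4 * d) * κ) ^ d)⁻¹ * (κ / (4 * d) * (κ * h)) ^ d := by
        rw [← mul_assoc, mul_pow _ h]
        field_simp
    _ ≤ _ := by gcongr

lemma interior_cell_ae_eq (K : Finset (E d)) :
    (interior (cell K) : Set (E d)) =ᵐ[volume] cell K :=
  interior_ae_eq_of_null_frontier ((convex_cell K).addHaar_frontier volume)

lemma FacetAdj.symm {S : Finset (Finset (E d))} {z : E d} {K L : Finset (E d)}
    (h : FacetAdj S z K L) : FacetAdj S z L K := by
  classical
  obtain ⟨h1, h2, h3, h4, h5⟩ := h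
  exact ⟨h2, h1, h4, h3, by rw [Finset.inter_comm]; convert h5⟩

lemma interior_cell_subset_meshDomain {S : Finset (Finset (E d))} {K : Finset (E d)}
    (hK : K ∈ S) : interior (cell K) ⊆ meshDomain S :=
  interior_mono (Set.subset_biUnion_of_mem (u := fun K => cell K) hK)

lemma mem_patch_iff {S : Finset (Finset (E d))} {K L : Finset (E d)} {z : E d} :
    L ∈ patch S K z ↔ L ∈ S ∧ Relation.ReflTransGen (FacetAdj S z) K L := by
  simp [patch]

lemma mem_of_mem_patch {S : Finset (Finset (E d))} {K L : Finset (E d)} {z : E d}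
    (hz : z ∈ K) (hL : L ∈ patch S K z) : z ∈ L := by
  rcases (mem_patch_iff.1 hL).2.cases_tail with h | ⟨M, _, h⟩
  · exact h ▸ hz
  · exact h.2.2.2.1

namespace IsMesh

variable {S : Finset (Finset (E d))} {h κ : ℝ}

lemma ne_of_facetAdj (hS : IsMesh S h κ) {z : E d} {K L : Finset (E d)}
    (hKL : FacetAdj S z K L) : K ≠ L := by
  classical
  rintro rfl
  obtain ⟨h1, -, -, -, h5⟩ := hKL
  have h6 : K.card = d := by simpa using h5
  have := (hS.isSimplex K h1).card_eq
  omega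

lemma subset_ball_of_mem (hS : IsMesh S h κ) {K : Finset (E d)} (hK : K ∈ S) {x : E d}
    (hx : x ∈ cell K) : cell K ⊆ Metric.closedBall x h := fun y hy =>
  hS.dist_le K hK y hy x hx

lemma volume_le_of_subset_closedBall (hd : 0 < d) {A : Set (E d)} {x : E d}
    (hA : A ⊆ Metric.closedBall x h) : volume A ≤ volume (Metric.ball (0 : E d) h) := by
  have : Nonempty (Fin d) := ⟨⟨0, hd⟩⟩
  refine (measure_mono hA).trans (le_of_eq ?_)
  rw [Measure.addHaar_closedBall_eq_addHaar_ball, Measure.addHaar_ball_center]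

/-- Simplices that share a facet are linked through balls near the centroid of the facet. -/
lemma exists_balls_of_facetAdj (hS : IsMesh S h κ) (hd : 0 < d) (hh : 0 < h) (hκ : 0 < κ)
    (hκ1 : κ ≤ 1) {z : E d} {K L : Finset (E d)} (hKL : FacetAdj S z K L) :
    ∃ m a b : E d,
      Metric.ball m (κ * h / (2 * d)) ⊆ cell K ∪ cell L ∧
      Metric.ball a (κ / (4 * d) * (κ * h)) ⊆
        interior (cell K) ∩ Metric.ball m (κ * h / (2 * d)) ∧
      Metric.ball b (κ / (4 * d) * (κ * h)) ⊆
        interior (cell L) ∩ Metric.ball m (κ * h / (2 * d)) := by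
  classical
  obtain ⟨hK, hL, -, -, hcard⟩ := hKL
  have hcard : (K ∩ L).card = d := by convert hcard
  have hd' : (1 : ℝ) ≤ d := by exact_mod_cast hd
  obtain ⟨x, hx⟩ := hS.exists_ball K hK
  obtain ⟨y, hy⟩ := hS.exists_ball L hL
  have hρ : 0 < κ * h := by positivity
  have key : ∀ M ∈ S, K ∩ L ⊆ M → ∀ x, Metric.ball x (κ * h) ⊆ cell M →
      ∃ a, Metric.ball a (κ / (4 * d) * (κ * h)) ⊆
        interior (cell M) ∩ Metric.ball ((d : ℝ)⁻¹ • ∑ f ∈ K ∩ L, f) (κ * h / (2 * d)) := by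
    intro M hM hsub x hx
    have hm := (hS.isSimplex M hM).centroid_mem_cell hsub hcard hd
    obtain ⟨a, ha⟩ := exists_ball_subset_near (convex_cell M) hm hx
      (hS.dist_le M hM x (hx (Metric.mem_ball_self hρ)) _ hm)
      (t := κ / (4 * d)) (by positivity) (by
        rw [div_le_one (by positivity)]; linarith)
    refine ⟨a, fun p hp => ⟨interior_maximal (fun q hq => (ha hq).1) Metric.isOpen_ball hp,
      Metric.ball_subset_ball ?_ (ha hp).2⟩⟩
    have : κ * h ≤ h := mul_le_of_le_one_left hh.le hκ1
    calc κ / (4 * d) * (h + κ * h) ≤ κ / (4 * d) * (h + h) := by gcongr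
      _ = _ := by field_simp; ring
  obtain ⟨a, ha⟩ := key K hK Finset.inter_subset_left x hx
  obtain ⟨b, hb⟩ := key L hL Finset.inter_subset_right y hy
  exact ⟨_, a, b, (hS.isSimplex K hK).ball_centroid_subset_union (hS.isSimplex L hL)
    (hS.conforming K hK L hL) hcard hd hρ hx hy, ha, hb⟩

/-- The volume of a simplex is bounded from below. -/
lemma volume_ball_le_mul_volume (hS : IsMesh S h κ) (hd : 0 < d) (hh : 0 < h) (hκ : 0 < κ)
    (hκ1 : κ ≤ 1) {K : Finset (E d)} (hK : K ∈ S) :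
    volume (Metric.ball (0 : E d) h) ≤ volRatio d κ * volume (interior (cell K)) := by
  obtain ⟨x, hx⟩ := hS.exists_ball K hK
  have hd' : (1 : ℝ) ≤ d := by exact_mod_cast hd
  refine (volume_ball_le_volRatio_mul hd hκ hh x).trans ?_
  gcongr
  refine interior_maximal ((Metric.ball_subset_ball ?_).trans hx) Metric.isOpen_ball
  exact mul_le_of_le_one_left (by positivity) (by rw [div_le_one (by positivity)]; linarith)

/-- The simplices of the patch have disjoint interiors inside the ball of radius `h` about `z`, and
each occupies at least the fraction `1 / volRatio d κ` of its volume. -/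
lemma card_patch_le (hS : IsMesh S h κ) (hd : 0 < d) (hh : 0 < h) (hκ : 0 < κ) (hκ1 : κ ≤ 1)
    {K : Finset (E d)} {z : E d} (hz : z ∈ K) : (patch S K z).card ≤ volRatio d κ := by
  set v := volume (Metric.ball (0 : E d) h) with hv
  have hv0 : v ≠ 0 := (Metric.measure_ball_pos volume _ hh).ne'
  have hvt : v ≠ ⊤ := measure_ball_lt_top.ne
  have hmem : ∀ L ∈ patch S K z, L ∈ S := fun L hL => (mem_patch_iff.1 hL).1
  have hdisj : (patch S K z : Set (Finset (E d))).PairwiseDisjoint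
      fun L => interior (cell L) := by
    intro L hL M hM hne
    refine Set.disjoint_left.2 fun x hx hx' => ?_
    exact (hS.isSimplex L (hmem L hL)).notMem_cell_of_mem_interior (hS.isSimplex M (hmem M hM))
      (hS.conforming L (hmem L hL) M (hmem M hM)) hne hx (interior_subset hx')
  have h1 : ((patch S K z).card : ℝ≥0∞) * v ≤ volRatio d κ * v := by
    calc ((patch S K z).card : ℝ≥0∞) * v = ∑ _L ∈ patch S K z, v := by simp
      _ ≤ ∑ L ∈ patch S K z, volRatio d κ * volume (interior (cell L)) :=
        Finset.sum_le_sum fun L hL => hS.volume_ball_le_mul_volume hd hh hκ hκ1 (hmem L hL)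
      _ = volRatio d κ * volume (⋃ L ∈ patch S K z, interior (cell L)) := by
        rw [measure_biUnion_finset hdisj fun L _ => isOpen_interior.measurableSet,
          Finset.mul_sum]
      _ ≤ volRatio d κ * v := by
        gcongr
        refine volume_le_of_subset_closedBall hd (x := z) (Set.iUnion₂_subset fun L hL => ?_)
        exact interior_subset.trans (hS.subset_ball_of_mem (hmem L hL)
          (subset_convexHull ℝ _ (mem_of_mem_patch hz hL)))
  rw [ENNReal.mul_le_mul_iff_left hv0 hvt] at h1
  exact_mod_cast h1

variable {w : E d → ℝ} {G : E d → E d}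

/-- A common form of the convex Poincaré inequality, for interiors of simplices as well as for the
balls around facet centroids. -/
lemma sqDiff_self_le_of_subset (hd : 0 < d) {U V : Set (E d)} {e : ℝ≥0∞} (hVo : IsOpen V)
    (hV : Convex ℝ V) (hVh : ∀ x ∈ V, ∀ y ∈ V, dist x y ≤ 2 * h) {c : E d}
    (hVc : V ⊆ Metric.closedBall c h) (hVU : V ⊆ U)
    (hGm : Measurable G) (hw2 : MemLp w 2 (volume.restrict U))
    (hG2 : MemLp G 2 (volume.restrict U)) (hwG : IsWeakGrad U w G)
    (he : ∫⁻ x in V, ‖G x‖ₑ ^ 2 ≤ e) :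
    sqDiff w V V ≤ 2 ^ d * ENNReal.ofReal ((2 * h) ^ 2) * volume (Metric.ball (0 : E d) h) * e := by
  have hmono := Measure.restrict_mono hVU (le_refl (volume : Measure (E d)))
  refine (sqDiff_le_of_isWeakGrad hVo hV hVh hGm (hw2.mono_measure hmono)
    (hG2.mono_measure hmono) (hwG.mono hVU)).trans ?_
  exact mul_le_mul' (mul_le_mul' le_rfl (volume_le_of_subset_closedBall hd hVc)) he

lemma lintegral_ball_le {K L : Finset (E d)} {B : Set (E d)} (hB : B ⊆ cell K ∪ cell L)
    {C : Finset (Finset (E d))} (hK : K ∈ C) (hL : L ∈ C) (hne : K ≠ L) (f : E d → ℝ≥0∞) :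
    ∫⁻ x in B, f x ≤ ∑ M ∈ C, ∫⁻ x in interior (cell M), f x := by
  classical
  calc ∫⁻ x in B, f x ≤ ∫⁻ x in cell K ∪ cell L, f x := lintegral_mono_set hB
    _ ≤ (∫⁻ x in cell K, f x) + ∫⁻ x in cell L, f x := lintegral_union_le _ _ _
    _ = (∫⁻ x in interior (cell K), f x) + ∫⁻ x in interior (cell L), f x := by
        rw [Measure.restrict_congr_set (interior_cell_ae_eq K),
          Measure.restrict_congr_set (interior_cell_ae_eq L)]
    _ = ∑ M ∈ {K, L}, ∫⁻ x in interior (cell M), f x := by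
        rw [Finset.sum_pair hne]
    _ ≤ _ := Finset.sum_le_sum_of_subset (by
        intro M hM
        rcases Finset.mem_insert.1 hM with rfl | hM
        · exact hK
        · exact Finset.mem_singleton.1 hM ▸ hL)

/-- The graph of the simplices in which neighbours share a facet containing `z`. -/
def facetGraph (hS : IsMesh S h κ) (z : E d) : SimpleGraph (Finset (E d)) where
  Adj := FacetAdj S z
  symm := ⟨fun _ _ h => h.symm⟩
  loopless := ⟨fun _ h => hS.ne_of_facetAdj h rfl⟩

lemma mem_patch_of_facetAdj {K₀ K L : Finset (E d)} {z : E d} (hL : L ∈ patch S K₀ z)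
    (hKL : FacetAdj S z K L) : K ∈ patch S K₀ z :=
  mem_patch_iff.2 ⟨hKL.1, (mem_patch_iff.1 hL).2.tail hKL.symm⟩

section Patch

variable (hS : IsMesh S h κ) (hd : 0 < d) (hh : 0 < h) (hκ : 0 < κ) (hκ1 : κ ≤ 1)
  (hwm : Measurable w) (hGm : Measurable G) (hw : MemLp w 2 (volume.restrict (meshDomain S)))
  (hG : MemLp G 2 (volume.restrict (meshDomain S))) (hwG : IsWeakGrad (meshDomain S) w G)
  {C : Finset (Finset (E d))}

include hS hd hGm hw hG hwG

lemma sqDiff_cell_self_le (hh : 0 < h) (hCS : C ⊆ S) {K : Finset (E d)} (hK : K ∈ C) :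
    sqDiff w (interior (cell K)) (interior (cell K)) ≤
      2 ^ d * ENNReal.ofReal ((2 * h) ^ 2) * volume (Metric.ball (0 : E d) h) *
        ∑ M ∈ C, ∫⁻ x in interior (cell M), ‖G x‖ₑ ^ 2 := by
  rcases (interior (cell K)).eq_empty_or_nonempty with h0 | ⟨c, hc⟩
  · simp [h0, sqDiff]
  refine sqDiff_self_le_of_subset hd isOpen_interior (convex_cell K).interior
    (fun x hx y hy => ?_) (interior_subset.trans (hS.subset_ball_of_mem (hCS hK)
      (interior_subset hc))) (interior_cell_subset_meshDomain (hCS hK)) hGm hw hG hwG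
    (Finset.single_le_sum (f := fun M => ∫⁻ x in interior (cell M), ‖G x‖ₑ ^ 2)
      (fun _ _ => bot_le) hK)
  have := hS.dist_le K (hCS hK) x (interior_subset hx) y (interior_subset hy)
  linarith

include hh hκ hκ1 hwm

/-- The chain is `K`, `A₁`, `A₂`, `L`, with `A₁` inside `K` and the facet ball `B`, and `A₂` inside
`L` and `B`. Each link lies in one of the convex sets `K`, `B`, `L`. Two triangle inequalities give
`2k + 8k² ≤ 12k²`. -/
lemma sqDiff_le_of_facetAdj (hCS : C ⊆ S) {z : E d} {K L : Finset (E d)}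
    (hKL : FacetAdj S z K L) (hK : K ∈ C) (hL : L ∈ C) :
    sqDiff w (interior (cell K)) (interior (cell L)) ≤ (12 * volRatio d κ ^ 2 : ℕ) *
      (2 ^ d * ENNReal.ofReal ((2 * h) ^ 2) * volume (Metric.ball (0 : E d) h) *
        ∑ M ∈ C, ∫⁻ x in interior (cell M), ‖G x‖ₑ ^ 2) := by
  obtain ⟨m, a, b, hB, ha, hb⟩ := hS.exists_balls_of_facetAdj hd hh hκ hκ1 hKL
  set B := Metric.ball m (κ * h / (2 * d)) with hBdef
  set A₁ := Metric.ball a (κ / (4 * d) * (κ * h)) with hA₁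
  set A₂ := Metric.ball b (κ / (4 * d) * (κ * h)) with hA₂
  set v := volume (Metric.ball (0 : E d) h) with hv
  set X := 2 ^ d * ENNReal.ofReal ((2 * h) ^ 2) * v *
        ∑ M ∈ C, ∫⁻ x in interior (cell M), ‖G x‖ₑ ^ 2 with hX
  set k := volRatio d κ with hk
  have hk1 : 1 ≤ k := one_le_volRatio hd hκ
  have hv0 : v ≠ 0 := (Metric.measure_ball_pos volume _ hh).ne'
  have hvt : v ≠ ⊤ := measure_ball_lt_top.ne
  have hd' : (1 : ℝ) ≤ d := by exact_mod_cast hd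
  have hr : κ * h / (2 * d) ≤ h := by
    rw [div_le_iff₀ (by positivity)]
    nlinarith [mul_le_of_le_one_left hh.le hκ1]
  have hBh : B ⊆ Metric.closedBall m h :=
    Metric.ball_subset_closedBall.trans (Metric.closedBall_subset_closedBall hr)
  have hBU : B ⊆ meshDomain S := by
    refine interior_maximal (hB.trans (Set.union_subset ?_ ?_)) Metric.isOpen_ball
    · exact Set.subset_biUnion_of_mem (u := fun K => cell K) (hCS hK)
    · exact Set.subset_biUnion_of_mem (u := fun K => cell K) (hCS hL)
  have hBB : sqDiff w B B ≤ X := by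
    refine sqDiff_self_le_of_subset hd Metric.isOpen_ball (convex_ball _ _)
      (fun x hx y hy => ?_) hBh hBU hGm hw hG hwG
      (lintegral_ball_le hB hK hL (hS.ne_of_facetAdj hKL) _)
    have h1 := Metric.mem_ball.1 hx
    have h2 := Metric.mem_ball'.1 hy
    linarith [dist_triangle x m y]
  have hcell : ∀ M ∈ C, volume (interior (cell M)) ≤ v := fun M hM => by
    obtain ⟨x, hx⟩ := hS.exists_ball M (hCS hM)
    exact volume_le_of_subset_closedBall hd (interior_subset.trans
      (hS.subset_ball_of_mem (hCS hM) (hx (Metric.mem_ball_self (by positivity)))))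
  have hv1 : volume A₁ ≤ v := (measure_mono (ha.trans Set.inter_subset_left)).trans (hcell K hK)
  have hv2 : volume A₂ ≤ v := (measure_mono (hb.trans Set.inter_subset_left)).trans (hcell L hL)
  have t1 : sqDiff w (interior (cell K)) A₁ ≤ X :=
    (sqDiff_mono subset_rfl (ha.trans Set.inter_subset_left)).trans
      (hS.sqDiff_cell_self_le hd hGm hw hG hwG hh hCS hK)
  have t2 : sqDiff w A₁ A₂ ≤ X := (sqDiff_mono (ha.trans Set.inter_subset_right)
      (hb.trans Set.inter_subset_right)).trans hBB
  have t3 : sqDiff w A₂ (interior (cell L)) ≤ X :=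
    (sqDiff_mono (hb.trans Set.inter_subset_left) subset_rfl).trans
      (hS.sqDiff_cell_self_le hd hGm hw hG hwG hh hCS hL)
  calc sqDiff w (interior (cell K)) (interior (cell L))
      ≤ 2 * k * (sqDiff w (interior (cell K)) A₁ + sqDiff w A₁ (interior (cell L))) :=
        sqDiff_triangle hwm hv0 hvt (hcell K hK) (hcell L hL) hv1
          (volume_ball_le_volRatio_mul hd hκ hh a)
    _ ≤ 2 * k * (X + 2 * k * (X + X)) := by
        gcongr
        refine (sqDiff_triangle hwm hv0 hvt hv1 (hcell L hL) hv2
          (volume_ball_le_volRatio_mul hd hκ hh b)).trans ?_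
        gcongr
    _ = (2 * k + 8 * k ^ 2 : ℕ) * X := by push_cast; ring
    _ ≤ (12 * k ^ 2 : ℕ) * X := by
        gcongr
        nlinarith

/-- Induction on the walk. An extra edge turns the factor `P` into `2k (12k² + P) ≤ 26k³ P`, as `P ≥
1`. The endpoint is a variable tied to `K₀` by an equation so that the induction applies. -/
lemma sqDiff_le_of_walk {z : E d} {K₀ : Finset (E d)} (hK₀ : K₀ ∈ S) {K L : Finset (E d)}
    (p : (hS.facetGraph z).Walk K L) (hL : L = K₀) :
    K ∈ patch S K₀ z ∧ sqDiff w (interior (cell K)) (interior (cell K₀)) ≤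
      ((26 * volRatio d κ ^ 3) ^ p.length : ℕ) *
      (2 ^ d * ENNReal.ofReal ((2 * h) ^ 2) * volume (Metric.ball (0 : E d) h) *
        ∑ M ∈ patch S K₀ z, ∫⁻ x in interior (cell M), ‖G x‖ₑ ^ 2) := by
  have hCS : patch S K₀ z ⊆ S := fun M hM => (mem_patch_iff.1 hM).1
  have hK₀p : K₀ ∈ patch S K₀ z := mem_patch_iff.2 ⟨hK₀, .refl⟩
  set v := volume (Metric.ball (0 : E d) h) with hv
  set X := 2 ^ d * ENNReal.ofReal ((2 * h) ^ 2) * v *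
        ∑ M ∈ patch S K₀ z, ∫⁻ x in interior (cell M), ‖G x‖ₑ ^ 2 with hX
  set k := volRatio d κ with hk
  have hk1 : 1 ≤ k := one_le_volRatio hd hκ
  have hv0 : v ≠ 0 := (Metric.measure_ball_pos volume _ hh).ne'
  have hvt : v ≠ ⊤ := measure_ball_lt_top.ne
  have hcell : ∀ M ∈ patch S K₀ z, volume (interior (cell M)) ≤ v := fun M hM => by
    obtain ⟨x, hx⟩ := hS.exists_ball M (hCS hM)
    exact volume_le_of_subset_closedBall hd (interior_subset.trans
      (hS.subset_ball_of_mem (hCS hM) (hx (Metric.mem_ball_self (by positivity)))))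
  induction p with
  | nil =>
    subst hL
    exact ⟨hK₀p, by simpa using hS.sqDiff_cell_self_le hd hGm hw hG hwG hh hCS hK₀p⟩
  | @cons K L M hKL p ih =>
    obtain ⟨hLC, hLd⟩ := ih hL
    have hKC := mem_patch_of_facetAdj hLC hKL
    refine ⟨hKC, ?_⟩
    calc sqDiff w (interior (cell K)) (interior (cell K₀))
        ≤ 2 * k * (sqDiff w (interior (cell K)) (interior (cell L)) +
          sqDiff w (interior (cell L)) (interior (cell K₀))) :=
          sqDiff_triangle hwm hv0 hvt (hcell K hKC) (hcell K₀ hK₀p) (hcell L hLC)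
            (hS.volume_ball_le_mul_volume hd hh hκ hκ1 (hCS hLC))
      _ ≤ 2 * k * ((12 * k ^ 2 : ℕ) * X + ((26 * k ^ 3) ^ p.length : ℕ) * X) := by
          gcongr
          exact hS.sqDiff_le_of_facetAdj hd hh hκ hκ1 hwm hGm hw hG hwG hCS hKL hKC hLC
      _ = (2 * k * (12 * k ^ 2 + (26 * k ^ 3) ^ p.length) : ℕ) * X := by push_cast; ring
      _ ≤ _ := by
          gcongr
          rw [SimpleGraph.Walk.length_cons, pow_succ (26 * k ^ 3) p.length]
          have h1 : 1 ≤ (26 * k ^ 3) ^ p.length := Nat.one_le_pow _ _ (by positivity)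
          have h2 : k ≤ k ^ 3 := by nlinarith [Nat.pow_le_pow_left hk1 2]
          generalize (26 * k ^ 3) ^ p.length = P at h1
          calc 2 * k * (12 * k ^ 2 + P) = 24 * k ^ 3 * 1 + 2 * k * P := by ring
            _ ≤ 24 * k ^ 3 * P + 2 * k ^ 3 * P := by gcongr
            _ = P * (26 * k ^ 3) := by ring

lemma sqDiff_le_of_mem_patch {z : E d} {K₀ K : Finset (E d)} (hK₀ : K₀ ∈ S) (hz : z ∈ K₀)
    (hK : K ∈ patch S K₀ z) : sqDiff w (interior (cell K)) (interior (cell K₀)) ≤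
      ((26 * volRatio d κ ^ 3) ^ volRatio d κ : ℕ) *
      (2 ^ d * ENNReal.ofReal ((2 * h) ^ 2) * volume (Metric.ball (0 : E d) h) *
        ∑ M ∈ patch S K₀ z, ∫⁻ x in interior (cell M), ‖G x‖ₑ ^ 2) := by
  classical
  have hreach : (hS.facetGraph z).Reachable K K₀ := by
    refine SimpleGraph.Reachable.symm ?_
    rw [SimpleGraph.reachable_iff_reflTransGen]
    exact (mem_patch_iff.1 hK).2
  obtain ⟨p, hp⟩ := hreach.exists_isPath
  refine (hS.sqDiff_le_of_walk hd hh hκ hκ1 hwm hGm hw hG hwG hK₀ p rfl).2.trans ?_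
  have hlen : p.length ≤ volRatio d κ := by
    -- Every simplex on the path starts a walk to `K₀`, so it belongs to the patch. A path has no
    -- repetitions, so the size of the patch bounds its length.
    have hsub : p.support.toFinset ⊆ patch S K₀ z := fun M hM =>
      (hS.sqDiff_le_of_walk hd hh hκ hκ1 hwm hGm hw hG hwG hK₀
        (p.dropUntil M (List.mem_toFinset.1 hM)) rfl).1
    have h1 := (Finset.card_le_card hsub).trans (hS.card_patch_le hd hh hκ hκ1 hz)
    rw [List.toFinset_card_of_nodup hp.support_nodup, SimpleGraph.Walk.length_support] at h1
    omega
  have hk1 : 1 ≤ volRatio d κ := one_le_volRatio hd hκ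
  gcongr
  have : 1 ≤ volRatio d κ ^ 3 := Nat.one_le_pow _ _ hk1
  omega

/-- **Poincaré inequality** on the patch of simplices around a vertex. -/
theorem exists_sum_lintegral_patch_le {z : E d} {K₀ : Finset (E d)} (hK₀ : K₀ ∈ S)
    (hz : z ∈ K₀) : ∃ c : ℝ,
      ∑ K ∈ patch S K₀ z, ∫⁻ x in interior (cell K), ‖w x - c‖ₑ ^ 2 ≤
        patchConst d κ * ENNReal.ofReal (h ^ 2) *
          ∑ K ∈ patch S K₀ z, ∫⁻ x in interior (cell K), ‖G x‖ₑ ^ 2 := by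
  set C := patch S K₀ z with hC
  set e := ∑ K ∈ C, ∫⁻ x in interior (cell K), ‖G x‖ₑ ^ 2 with he
  set v := volume (Metric.ball (0 : E d) h) with hv
  set k := volRatio d κ with hk
  have hv0 : v ≠ 0 := (Metric.measure_ball_pos volume _ hh).ne'
  have hvK : v ≤ k * volume (interior (cell K₀)) :=
    hS.volume_ball_le_mul_volume hd hh hκ hκ1 hK₀
  have hA0 : volume (interior (cell K₀)) ≠ 0 := by
    intro h
    rw [h, mul_zero] at hvK
    exact hv0 (le_antisymm hvK bot_le)
  have hAt : volume (interior (cell K₀)) ≠ ⊤ :=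
    ((measure_mono interior_subset).trans_lt (isCompact_cell K₀).measure_lt_top).ne
  obtain ⟨c, hc⟩ := exists_sum_lintegral_sub_le hwm C (fun K => interior (cell K)) hA0 hAt
  refine ⟨c, ?_⟩
  rw [← ENNReal.mul_le_mul_iff_right hA0 hAt]
  calc _ ≤ ∑ K ∈ C, sqDiff w (interior (cell K₀)) (interior (cell K)) := hc
    _ ≤ ∑ _K ∈ C, ((26 * k ^ 3) ^ k : ℕ) * (2 ^ d * ENNReal.ofReal ((2 * h) ^ 2) * v * e) :=
        Finset.sum_le_sum fun K hK => by
          rw [sqDiff_comm hwm]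
          exact hS.sqDiff_le_of_mem_patch hd hh hκ hκ1 hwm hGm hw hG hwG hK₀ hz hK
    _ = (C.card : ℝ≥0∞) *
        (((26 * k ^ 3) ^ k : ℕ) * (2 ^ d * ENNReal.ofReal ((2 * h) ^ 2) * v * e)) := by simp
    _ ≤ k * (((26 * k ^ 3) ^ k : ℕ) * (2 ^ d * ENNReal.ofReal ((2 * h) ^ 2) *
        (k * volume (interior (cell K₀))) * e)) := by
        gcongr
        exact hS.card_patch_le hd hh hκ hκ1 hz
    _ = _ := by
        -- In `patchConst`, the 4 comes from `(2h)²` and `2 ^ d` from the convex inequality. One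
        -- factor `k` counts the patch, the other compares `v` with the volume of `K₀`, and the
        -- power is the cost of the chain.
        rw [patchConst, mul_pow 2 h, ENNReal.ofReal_mul (by norm_num)]
        norm_num
        ring

end Patch

end IsMesh

end PG

namespace PG

open scoped ENNReal

/-! ### The nodal basis is a partition of unity -/

variable {d : ℕ} {S : Finset (Finset (E d))} {h κ : ℝ}

lemma mem_nodes_iff {j : E d × Finset (Finset (E d))} :
    j ∈ nodes S ↔ ∃ K ∈ S, ∃ z ∈ K, (z, patch S K z) = j := by
  simp [nodes]

/-- Facet adjacency is symmetric, so the patches at a vertex are equivalence classes. -/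
lemma patch_eq_of_mem {K L : Finset (E d)} {z : E d} (hL : L ∈ patch S K z) :
    patch S L z = patch S K z := by
  have hKL := (mem_patch_iff.1 hL).2
  have hLK : Relation.ReflTransGen (FacetAdj S z) L K :=
    have : Std.Symm (FacetAdj S z) := ⟨fun _ _ h => h.symm⟩
    Std.Symm.symm _ _ hKL
  ext M
  rw [mem_patch_iff, mem_patch_iff]
  exact and_congr_right fun _ => ⟨hKL.trans, hLK.trans⟩

lemma eq_of_mem_nodes {j : E d × Finset (Finset (E d))} (hj : j ∈ nodes S) {K : Finset (E d)}
    (hK : K ∈ j.2) : K ∈ S ∧ j.1 ∈ K ∧ j = (j.1, patch S K j.1) := by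
  obtain ⟨L, -, z, hz, rfl⟩ := mem_nodes_iff.1 hj
  exact ⟨(mem_patch_iff.1 hK).1, mem_of_mem_patch hz hK, by simp [patch_eq_of_mem hK]⟩

open Classical in
-- The nodes active on `K` correspond to the vertices of `K`, even where the domain is pinched and a
-- vertex carries several nodes.
lemma filter_nodes_eq_image {K : Finset (E d)} (hK : K ∈ S) :
    (nodes S).filter (fun j => K ∈ j.2) = K.image fun z => (z, patch S K z) := by
  ext j
  rw [Finset.mem_filter, Finset.mem_image]
  constructor
  · rintro ⟨hj, hKj⟩
    obtain ⟨-, h2, h3⟩ := eq_of_mem_nodes hj hKj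
    exact ⟨j.1, h2, h3.symm⟩
  · rintro ⟨z, hz, rfl⟩
    exact ⟨mem_nodes_iff.2 ⟨K, hK, z, hz, rfl⟩, mem_patch_iff.2 ⟨hK, .refl⟩⟩

open Classical in
/-- Every simplex belongs to as many patches as it has vertices. -/
lemma sum_nodes_sum_eq (hS : ∀ K ∈ S, K.card = d + 1) (a : Finset (E d) → ℝ≥0∞) :
    ∑ j ∈ nodes S, ∑ K ∈ j.2, a K = (d + 1 : ℕ) * ∑ K ∈ S, a K := by
  have h1 : ∀ j ∈ nodes S, ∑ K ∈ j.2, a K = ∑ K ∈ S, if K ∈ j.2 then a K else 0 := by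
    intro j hj
    rw [← Finset.sum_filter]
    refine Finset.sum_congr ?_ fun _ _ => rfl
    ext K
    rw [Finset.mem_filter]
    exact ⟨fun hK => ⟨(eq_of_mem_nodes hj hK).1, hK⟩, fun hK => hK.2⟩
  rw [Finset.sum_congr rfl h1, Finset.sum_comm, Finset.mul_sum]
  refine Finset.sum_congr rfl fun K hK => ?_
  rw [← Finset.sum_filter, filter_nodes_eq_image hK, Finset.sum_const,
    Finset.card_image_of_injective _ (fun _ _ h => (Prod.mk.inj h).1), hS K hK, nsmul_eq_mul]

namespace IsMesh

lemma eq_of_mem_cell (hS : IsMesh S h κ) {K L : Finset (E d)} (hK : K ∈ S) (hL : L ∈ S) {x : E d}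
    (hx : x ∈ interior (cell K)) (hxL : x ∈ cell L) : L = K := by
  by_contra hne
  exact (hS.isSimplex K hK).notMem_cell_of_mem_interior (hS.isSimplex L hL)
    (hS.conforming K hK L hL) (Ne.symm hne) hx hxL

open Classical in
-- An interior point of `K` lies in no other simplex, so the choice made in `hat` is forced.
lemma hat_eq (hS : IsMesh S h κ) {j : E d × Finset (Finset (E d))} (hj : j ∈ nodes S)
    {K : Finset (E d)} (hK : K ∈ S) {x : E d} (hx : x ∈ interior (cell K)) :
    hat j x = if K ∈ j.2 then bary K j.1 x else 0 := by
  have huniq : ∀ L ∈ j.2, x ∈ cell L → L = K := fun L hL hxL =>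
    hS.eq_of_mem_cell hK (eq_of_mem_nodes hj hL).1 hx hxL
  by_cases hKj : K ∈ j.2
  · have hex : ∃ L ∈ j.2, x ∈ cell L := ⟨K, hKj, interior_subset hx⟩
    rw [hat, dif_pos hex, if_pos hKj, huniq _ hex.choose_spec.1 hex.choose_spec.2]
  · rw [hat, dif_neg, if_neg hKj]
    rintro ⟨L, hL, hxL⟩
    exact hKj (huniq L hL hxL ▸ hL)

lemma hat_mem_Icc (hS : IsMesh S h κ) {j : E d × Finset (Finset (E d))} (hj : j ∈ nodes S)
    {K : Finset (E d)} (hK : K ∈ S) {x : E d} (hx : x ∈ interior (cell K)) :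
    0 ≤ hat j x ∧ hat j x ≤ 1 := by
  classical
  rw [hS.hat_eq hj hK hx]
  split_ifs with hKj
  · have hz := (eq_of_mem_nodes hj hKj).2.1
    exact ⟨(hS.isSimplex K hK).mem_cell_iff.1 (interior_subset hx) _ hz,
      (hS.isSimplex K hK).bary_le_one hz (interior_subset hx)⟩
  · simp

lemma sum_hat (hS : IsMesh S h κ) {K : Finset (E d)} (hK : K ∈ S) {x : E d}
    (hx : x ∈ interior (cell K)) : ∑ j ∈ nodes S, hat j x = 1 := by
  classical
  rw [Finset.sum_congr rfl fun j hj => hS.hat_eq hj hK hx, ← Finset.sum_filter,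
    filter_nodes_eq_image hK, Finset.sum_image fun _ _ _ _ h => (Prod.mk.inj h).1]
  exact (hS.isSimplex K hK).sum_bary x

end IsMesh

lemma isFiniteMeasure_restrict_meshDomain (S : Finset (Finset (E d))) :
    IsFiniteMeasure (volume.restrict (meshDomain S)) := by
  have : IsCompact (⋃ K ∈ S, cell K) := S.isCompact_biUnion fun K _ => isCompact_cell K
  exact ⟨by simpa [meshDomain] using (measure_mono interior_subset).trans_lt this.measure_lt_top⟩

/-- Boundaries of convex sets are null. Pointwise properties of the nodal functions then need
checking only inside simplices. -/
lemma ae_mem_interior_cell (S : Finset (Finset (E d))) :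
    ∀ᵐ x ∂volume.restrict (meshDomain S), ∃ K ∈ S, x ∈ interior (cell K) := by
  have h0 : ∀ᵐ x : E d, ∀ K ∈ S, x ∉ frontier (cell K) := by
    rw [Finset.eventually_all]
    exact fun K _ => measure_eq_zero_iff_ae_notMem.1 ((convex_cell K).addHaar_frontier volume)
  rw [meshDomain, ae_restrict_iff' isOpen_interior.measurableSet]
  filter_upwards [h0] with x hx hxS
  obtain ⟨K, hK, hxK⟩ := Set.mem_iUnion₂.1 (interior_subset hxS)
  refine ⟨K, hK, ?_⟩
  by_contra hc
  exact hx K hK ⟨subset_closure hxK, hc⟩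

lemma IsMesh.aestronglyMeasurable_hat (hS : IsMesh S h κ) {j : E d × Finset (Finset (E d))}
    (hj : j ∈ nodes S) : AEStronglyMeasurable (hat j) (volume.restrict (meshDomain S)) := by
  classical
  have hm : Measurable fun x => ∑ K ∈ S,
      (interior (cell K)).indicator (fun x => if K ∈ j.2 then bary K j.1 x else 0) x := by
    refine Finset.measurable_sum S fun K hK => Measurable.indicator ?_
      isOpen_interior.measurableSet
    by_cases hKj : K ∈ j.2
    · simpa only [hKj, if_true] using
        ((hS.isSimplex K hK).continuous_bary (eq_of_mem_nodes hj hKj).2.1).measurable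
    · simp only [hKj, if_false, measurable_const]
  refine hm.aestronglyMeasurable.congr ?_
  filter_upwards [ae_mem_interior_cell S] with x ⟨K, hK, hx⟩
  rw [hS.hat_eq hj hK hx, Finset.sum_eq_single_of_mem K hK, Set.indicator_of_mem hx]
  intro L hL hLK
  exact Set.indicator_of_notMem
    (fun hxL => hLK (hS.eq_of_mem_cell hK hL hx (interior_subset hxL))) _

/-! ### Sobolev functions -/

variable {U : Set (E d)} {u v : E d → ℝ}

lemma MemH1.memLp_weakGrad (hu : MemH1 U u) : MemLp (weakGrad U u) 2 (volume.restrict U) := by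
  rw [weakGrad, dif_pos hu.2]
  exact hu.2.choose_spec.1

lemma MemH1.isWeakGrad (hu : MemH1 U u) : IsWeakGrad U u (weakGrad U u) := by
  rw [weakGrad, dif_pos hu.2]
  exact hu.2.choose_spec.2

/-- This allows a passage to Borel representatives, which the patch inequality requires. -/
lemma IsWeakGrad.congr_ae {u' : E d → ℝ} {G G' : E d → E d} (h : IsWeakGrad U u G)
    (hu : u =ᵐ[volume.restrict U] u') (hG : G =ᵐ[volume.restrict U] G') :
    IsWeakGrad U u' G' := by
  intro φ hφ hc hs i
  have h1 : ∫ x in U, u' x * fderiv ℝ φ x (EuclideanSpace.single i (1 : ℝ)) =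
      ∫ x in U, u x * fderiv ℝ φ x (EuclideanSpace.single i (1 : ℝ)) := by
    refine integral_congr_ae ?_
    filter_upwards [hu] with x hx
    rw [hx]
  have h2 : ∫ x in U, G' x i * φ x = ∫ x in U, G x i * φ x := by
    refine integral_congr_ae ?_
    filter_upwards [hG] with x hx
    rw [hx]
  rw [h1, h2]
  exact h φ hφ hc hs i

lemma sqrt_integral_weakGrad_le_normH1 (U : Set (E d)) (u : E d → ℝ) :
    √(∫ x in U, ‖weakGrad U u x‖ ^ 2) ≤ normH1 U u := by
  refine Real.sqrt_le_sqrt ?_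
  have : 0 ≤ ∫ x in U, u x ^ 2 := integral_nonneg fun x => sq_nonneg _
  rw [normSqH1]
  linarith

lemma sum_integral_weakGrad_weakPartial_le (U : Set (E d)) (u : E d → ℝ) :
    ∑ i : Fin d, ∫ x in U, ‖weakGrad U (weakPartial U u i) x‖ ^ 2 ≤ normH2 U u ^ 2 := by
  have h1 : 0 ≤ normSqH1 U u := add_nonneg (integral_nonneg fun x => sq_nonneg _)
    (integral_nonneg fun x => sq_nonneg _)
  have h2 : 0 ≤ ∑ i : Fin d, ∫ x in U, ‖weakGrad U (weakPartial U u i) x‖ ^ 2 :=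
    Finset.sum_nonneg fun i _ => integral_nonneg fun x => sq_nonneg _
  rw [normH2, Real.sq_sqrt (by rw [normSqH2]; positivity), normSqH2]
  linarith

lemma ofReal_integral_norm_sq {F : Type*} [NormedAddCommGroup F] {μ : Measure (E d)} [IsFiniteMeasure μ]
    {G : E d → F} (hG : MemLp G 2 μ) :
    ENNReal.ofReal (∫ x, ‖G x‖ ^ 2 ∂μ) = ∫⁻ x, ‖G x‖ₑ ^ 2 ∂μ := by
  rw [ofReal_integral_eq_lintegral_ofReal hG.integrable_norm_pow'
    (Filter.Eventually.of_forall fun x => sq_nonneg _)]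
  exact lintegral_congr fun x => by rw [ENNReal.ofReal_pow (norm_nonneg _), ofReal_norm]

/-! ### The two estimates -/

lemma stab_eq (S : Finset (Finset (E d))) (D : Set (E d)) (u v : E d → ℝ) :
    stab S D u v = ∫ x in meshDomain S, inner ℝ (weakGrad (meshDomain S) u x -
      meanProj (volume.restrict (meshDomain S)) (freeNodes S D) hat
        (weakGrad (meshDomain S) u) x) (weakGrad (meshDomain S) v x) := rfl

lemma freeNodes_subset (S : Finset (Finset (E d))) (D : Set (E d)) :
    freeNodes S D ⊆ nodes S := by
  classical exact Finset.filter_subset _ _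

lemma freeNodes_empty (S : Finset (Finset (E d))) : freeNodes S ∅ = nodes S := by
  simp [freeNodes]

theorem IsMesh.abs_stab_le (hS : IsMesh S h κ) (D : Set (E d)) (hu : MemH1 (meshDomain S) u)
    (hv : MemH1 (meshDomain S) v) :
    |stab S D u v| ≤ 2 * (normH1 (meshDomain S) u * normH1 (meshDomain S) v) := by
  have := isFiniteMeasure_restrict_meshDomain S
  rw [stab_eq]
  refine (abs_integral_inner_sub_meanProj_le
    (fun j hj => hS.aestronglyMeasurable_hat (freeNodes_subset S D hj)) ?_ ?_
    hu.memLp_weakGrad hv.memLp_weakGrad).trans ?_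
  · filter_upwards [ae_mem_interior_cell S] with x ⟨K, hK, hx⟩ j hj
    exact hS.hat_mem_Icc (freeNodes_subset S D hj) hK hx
  · filter_upwards [ae_mem_interior_cell S] with x ⟨K, hK, hx⟩
    rw [← hS.sum_hat hK hx]
    exact Finset.sum_le_sum_of_subset_of_nonneg (freeNodes_subset S D)
      fun j hj _ => (hS.hat_mem_Icc hj hK hx).1
  · gcongr
    · exact Real.sqrt_nonneg _
    · exact sqrt_integral_weakGrad_le_normH1 _ _
    · exact sqrt_integral_weakGrad_le_normH1 _ _

lemma IsMesh.sum_lintegral_le (hS : IsMesh S h κ) (f : E d → ℝ≥0∞) :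
    ∑ K ∈ S, ∫⁻ x in interior (cell K), f x ≤ ∫⁻ x in meshDomain S, f x := by
  rw [← lintegral_biUnion_finset]
  · exact lintegral_mono_set (Set.iUnion₂_subset fun K hK => interior_cell_subset_meshDomain hK)
  · intro K hK L hL hne
    exact Set.disjoint_left.2 fun x hx hx' =>
      hne (hS.eq_of_mem_cell hK hL hx (interior_subset hx')).symm
  · exact fun K _ => isOpen_interior.measurableSet

/-- The weighted deviation of a vector field from a constant is controlled on the patch. -/
lemma IsMesh.lintegral_hat_mul_le (hS : IsMesh S h κ) {j : E d × Finset (Finset (E d))}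
    (hj : j ∈ nodes S) {w : E d → E d} {W : Fin d → E d → ℝ} (hWm : ∀ i, Measurable (W i))
    (hW : ∀ i, (fun x => w x i) =ᵐ[volume.restrict (meshDomain S)] W i) (c : E d) :
    ∫⁻ x in meshDomain S, ENNReal.ofReal (hat j x * ‖w x - c‖ ^ 2) ≤
      ∑ i, ∑ K ∈ j.2, ∫⁻ x in interior (cell K), ‖W i x - c i‖ₑ ^ 2 := by
  classical
  have hm : ∀ i, Measurable fun x => ‖W i x - c i‖ₑ ^ 2 := fun i =>
    (((hWm i).sub measurable_const).enorm).pow_const 2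
  calc ∫⁻ x in meshDomain S, ENNReal.ofReal (hat j x * ‖w x - c‖ ^ 2)
      ≤ ∫⁻ x in meshDomain S, ∑ i, ∑ K ∈ j.2,
          (interior (cell K)).indicator (fun x => ‖W i x - c i‖ₑ ^ 2) x := by
        refine lintegral_mono_ae ?_
        filter_upwards [ae_mem_interior_cell S, ae_all_iff.2 hW] with x ⟨K, hK, hx⟩ hWx
        by_cases hKj : K ∈ j.2
        · calc ENNReal.ofReal (hat j x * ‖w x - c‖ ^ 2)
              ≤ ENNReal.ofReal (∑ i, (W i x - c i) ^ 2) := by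
                apply ENNReal.ofReal_le_ofReal
                refine (mul_le_of_le_one_left (sq_nonneg _) (hS.hat_mem_Icc hj hK hx).2).trans
                  (le_of_eq ?_)
                rw [EuclideanSpace.norm_sq_eq]
                refine Finset.sum_congr rfl fun i _ => ?_
                rw [Real.norm_eq_abs, sq_abs, ← hWx i]
                rfl
            _ = ∑ i, ‖W i x - c i‖ₑ ^ 2 := by
                rw [ENNReal.ofReal_sum_of_nonneg fun i _ => sq_nonneg _]
                refine Finset.sum_congr rfl fun i _ => ?_
                rw [Real.enorm_eq_ofReal_abs, ← ENNReal.ofReal_pow (abs_nonneg _), sq_abs]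
            _ ≤ _ := by
                refine Finset.sum_le_sum fun i _ => ?_
                refine le_trans (le_of_eq ?_) (Finset.single_le_sum (fun _ _ => bot_le) hKj)
                rw [Set.indicator_of_mem hx]
        · rw [hS.hat_eq hj hK hx, if_neg hKj, zero_mul, ENNReal.ofReal_zero]
          exact bot_le
    _ = ∑ i, ∑ K ∈ j.2, ∫⁻ x in meshDomain S,
          (interior (cell K)).indicator (fun x => ‖W i x - c i‖ₑ ^ 2) x := by
        have hmi : ∀ i K, Measurable
            ((interior (cell K)).indicator fun x => ‖W i x - c i‖ₑ ^ 2) := fun i K =>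
          (hm i).indicator isOpen_interior.measurableSet
        rw [lintegral_finsetSum _ fun i _ => Finset.measurable_sum _ fun K _ => hmi i K]
        exact Finset.sum_congr rfl fun i _ => lintegral_finsetSum _ fun K _ => hmi i K
    _ ≤ _ := by
        refine Finset.sum_le_sum fun i _ => Finset.sum_le_sum fun K _ => ?_
        rw [← lintegral_indicator isOpen_interior.measurableSet]
        exact setLIntegral_le_lintegral _ _

/-- The patch inequality is applied to each component of `∇u`, and the resulting constants form the
vector subtracted at the node. -/
theorem IsMesh.stab_self_le (hS : IsMesh S h κ) (hd : 0 < d) (hh : 0 < h) (hκ : 0 < κ)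
    (hκ1 : κ ≤ 1) (hu : MemH2 (meshDomain S) u) :
    stab S ∅ u u ≤ ((d + 1 : ℕ) * patchConst d κ : ℝ) * h ^ 2 * normH2 (meshDomain S) u ^ 2 := by
  have hfin := isFiniteMeasure_restrict_meshDomain S
  set U := meshDomain S with hU
  set w := weakGrad U u with hw
  have hwL : MemLp w 2 (volume.restrict U) := hu.1.memLp_weakGrad
  have hW := fun i => (hu.2 i).1.1.aemeasurable
  have hΓ := fun i => (hu.2 i).memLp_weakGrad.1.aemeasurable
  let W : Fin d → E d → ℝ := fun i => (hW i).mk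
  let Γ : Fin d → E d → E d := fun i => (hΓ i).mk
  have hWm : ∀ i, Measurable (W i) := fun i => (hW i).measurable_mk
  have hΓm : ∀ i, Measurable (Γ i) := fun i => (hΓ i).measurable_mk
  have hWe : ∀ i, weakPartial U u i =ᵐ[volume.restrict U] W i := fun i => (hW i).ae_eq_mk
  have hΓe : ∀ i, weakGrad U (weakPartial U u i) =ᵐ[volume.restrict U] Γ i := fun i =>
    (hΓ i).ae_eq_mk
  have hc : ∀ j : E d × Finset (Finset (E d)), ∀ i : Fin d, ∃ c : ℝ, j ∈ nodes S →
      ∑ K ∈ j.2, ∫⁻ x in interior (cell K), ‖W i x - c‖ₑ ^ 2 ≤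
        patchConst d κ * ENNReal.ofReal (h ^ 2) *
          ∑ K ∈ j.2, ∫⁻ x in interior (cell K), ‖Γ i x‖ₑ ^ 2 := by
    intro j i
    by_cases hj : j ∈ nodes S
    · obtain ⟨K₀, hK₀, z, hz, rfl⟩ := mem_nodes_iff.1 hj
      obtain ⟨c, hc⟩ := hS.exists_sum_lintegral_patch_le hd hh hκ hκ1 (hWm i) (hΓm i)
        ((memLp_congr_ae (hWe i)).1 (hu.2 i).1) ((memLp_congr_ae (hΓe i)).1 (hu.2 i).memLp_weakGrad)
        ((hu.2 i).isWeakGrad.congr_ae (hWe i) (hΓe i)) hK₀ hz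
      exact ⟨c, fun _ => hc⟩
    -- A default value off the nodes, so that `choose` yields a total function.
    · exact ⟨0, fun hj' => absurd hj' hj⟩
  choose c hc using hc
  have hIcc : ∀ᵐ x ∂volume.restrict U, ∀ j ∈ nodes S, 0 ≤ hat j x ∧ hat j x ≤ 1 := by
    filter_upwards [ae_mem_interior_cell S] with x ⟨K, hK, hx⟩ j hj
    exact hS.hat_mem_Icc hj hK hx
  let cv : E d × Finset (Finset (E d)) → E d := fun j => WithLp.toLp 2 (c j)
  have h1 : stab S ∅ u u ≤
      ∑ j ∈ nodes S, ∫ x in U, hat j x * ‖w x - cv j‖ ^ 2 := by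
    rw [stab_eq, freeNodes_empty]
    refine integral_inner_sub_meanProj_self_le
      (fun j hj => hS.aestronglyMeasurable_hat hj) hIcc ?_ hwL cv
    filter_upwards [ae_mem_interior_cell S] with x ⟨K, hK, hx⟩
    exact hS.sum_hat hK hx
  refine h1.trans ?_
  have hnn : 0 ≤ ((d + 1 : ℕ) * patchConst d κ : ℝ) * h ^ 2 := by positivity
  refine le_trans ?_ (mul_le_mul_of_nonneg_left
    (sum_integral_weakGrad_weakPartial_le U u) hnn)
  have hGnn : ∀ i ∈ Finset.univ, 0 ≤ ∫ x in U, ‖weakGrad U (weakPartial U u i) x‖ ^ 2 :=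
    fun i _ => integral_nonneg fun x => sq_nonneg _
  rw [← ENNReal.ofReal_le_ofReal_iff (mul_nonneg hnn (Finset.sum_nonneg hGnn)),
    ENNReal.ofReal_sum_of_nonneg fun j hj => integral_nonneg_of_ae (hIcc.mono fun x hx =>
      mul_nonneg (hx j hj).1 (sq_nonneg _))]
  have h2 : ∀ j ∈ nodes S, ENNReal.ofReal (∫ x in U, hat j x * ‖w x - cv j‖ ^ 2) ≤
      ∑ i, patchConst d κ * ENNReal.ofReal (h ^ 2) *
        ∑ K ∈ j.2, ∫⁻ x in interior (cell K), ‖Γ i x‖ₑ ^ 2 := by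
    intro j hj
    rw [ofReal_integral_eq_lintegral_ofReal]
    · refine (hS.lintegral_hat_mul_le hj hWm hWe (cv j)).trans ?_
      exact Finset.sum_le_sum fun i _ => hc j i hj
    · exact integrable_smul_of_bounded (hS.aestronglyMeasurable_hat hj)
        (hIcc.mono fun x hx => hx j hj) ((hwL.sub (memLp_const _)).integrable_norm_pow')
    · exact hIcc.mono fun x hx => mul_nonneg (hx j hj).1 (sq_nonneg _)
  refine (Finset.sum_le_sum h2).trans ?_
  rw [Finset.sum_comm, ENNReal.ofReal_mul hnn, ENNReal.ofReal_sum_of_nonneg hGnn, Finset.mul_sum]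
  refine Finset.sum_le_sum fun i _ => ?_
  -- The overlap of the patches enters here: each simplex is counted `d + 1` times.
  rw [← Finset.mul_sum, sum_nodes_sum_eq fun K hK => (hS.isSimplex K hK).card_eq,
    ofReal_integral_norm_sq (hu.2 i).memLp_weakGrad, ENNReal.ofReal_mul (by positivity),
    ENNReal.ofReal_mul (by positivity), ENNReal.ofReal_natCast, ENNReal.ofReal_natCast]
  have h3 : ∫⁻ x in U, ‖weakGrad U (weakPartial U u i) x‖ₑ ^ 2 = ∫⁻ x in U, ‖Γ i x‖ₑ ^ 2 := by
    refine lintegral_congr_ae ?_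
    filter_upwards [hΓe i] with x hx
    rw [hx]
  rw [h3]
  calc _ ≤ patchConst d κ * ENNReal.ofReal (h ^ 2) *
        ((d + 1 : ℕ) * ∫⁻ x in U, ‖Γ i x‖ₑ ^ 2) := by
        gcongr
        exact hS.sum_lintegral_le _
    _ = _ := by ring

/-! ### Shape regular and quasiuniform triangulations -/

namespace Triangulation

variable {Ω : Set (E d)} {σ τ : ℝ}

lemma diam_cell_le_meshSize (T : Triangulation Ω) {K : Finset (E d)} (hK : K ∈ T.cells) :
    Metric.diam (cell K) ≤ T.meshSize :=
  le_ciSup (f := fun K : T.cells => Metric.diam (cell (K : Finset (E d))))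
    (Set.finite_range _).bddAbove ⟨K, hK⟩

lemma diam_cell_pos (T : Triangulation Ω) (hd : 0 < d) {K : Finset (E d)} (hK : K ∈ T.cells) :
    0 < Metric.diam (cell K) := by
  obtain ⟨a, ha, b, hb, hab⟩ := Finset.one_lt_card.1 (by rw [T.card_eq K hK]; omega)
  exact (dist_pos.2 hab).trans_le (Metric.dist_le_diam_of_mem (isCompact_cell K).isBounded
    (subset_convexHull ℝ _ ha) (subset_convexHull ℝ _ hb))

/-- Combining `h ≤ τ diam K` with `diam K ≤ σ ρ` gives `ρ ≥ h / (σ τ)`. The minimum with 1 ensures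
`κ ≤ 1`; any one simplex forces `σ` and `τ` to be positive. -/
lemma isMesh (T : Triangulation Ω) (hd : 0 < d) (hσ : T.ShapeRegular σ) (hτ : T.QuasiUniform τ)
    (hne : T.cells.Nonempty) {S : Finset (Finset (E d))} (hS : S ⊆ T.cells) :
    IsMesh S T.meshSize (min 1 (1 / (σ * τ))) ∧ 0 < T.meshSize ∧ 0 < min 1 (1 / (σ * τ)) := by
  have hpos : 0 < T.meshSize ∧ 0 < σ ∧ 0 < τ := by
    obtain ⟨K, hK⟩ := hne
    have h1 := T.diam_cell_pos hd hK
    have h2 := T.diam_cell_le_meshSize hK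
    obtain ⟨x, ρ, hρ, -, h3⟩ := hσ K hK
    exact ⟨h1.trans_le h2, pos_of_mul_pos_left (h1.trans_le h3) hρ.le,
      pos_of_mul_pos_left ((h1.trans_le h2).trans_le (hτ K hK)) h1.le⟩
  obtain ⟨hh, hσ0, hτ0⟩ := hpos
  refine ⟨⟨fun K hK => ⟨T.card_eq K (hS hK), T.affineIndependent K (hS hK)⟩,
    fun K hK L hL => T.conforming K (hS hK) L (hS hL), fun K hK x hx y hy =>
    (Metric.dist_le_diam_of_mem (isCompact_cell K).isBounded hx hy).trans
      (T.diam_cell_le_meshSize (hS hK)), fun K hK => ?_⟩, hh, by positivity⟩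
  obtain ⟨x, ρ, hρ, hb, h3⟩ := hσ K (hS hK)
  refine ⟨x, (Metric.ball_subset_ball ?_).trans hb⟩
  calc min 1 (1 / (σ * τ)) * T.meshSize ≤ 1 / (σ * τ) * (τ * (σ * ρ)) := by
        gcongr
        · exact min_le_right _ _
        · exact (hτ K (hS hK)).trans (by gcongr)
    _ = ρ := by field_simp

lemma cells_nonempty (T : Triangulation Ω) (hΩ : Ω.Nonempty) : T.cells.Nonempty := by
  obtain ⟨x, hx⟩ := hΩ
  have h1 : x ∈ ⋃ K ∈ T.cells, cell K := T.cover ▸ subset_closure hx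
  obtain ⟨K, hK, -⟩ := Set.mem_iUnion₂.1 h1
  exact ⟨K, hK⟩

end Triangulation

end PG

theorem lemma4p4 (d : ℕ) (hd : d = 2 ∨ d = 3) (σ τ : ℝ) :
    ∃ c : ℝ, 0 < c ∧
      ∀ (Ω Ωk : Set (PG.E d)), IsOpen Ω → IsOpen Ωk → Ωk.Nonempty → Ωk ⊆ Ω →
      ∀ T : PG.Triangulation Ω, T.ShapeRegular σ → T.QuasiUniform τ →
      ∀ δ : ℝ, 0 ≤ δ →
      ∀ (S : Finset (Finset (PG.E d))) (Ωh : Set (PG.E d)),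
        S = T.subcells Ωk δ → Ωh = PG.meshDomain S →
        -- continuity, with and without the nodes on the outer boundary
        (∀ D : Set (PG.E d), D = ∅ ∨ D = frontier Ω ∩ frontier Ωh →
          ∀ u v : PG.E d → ℝ, PG.MemH1 Ωh u → PG.MemH1 Ωh v →
            |PG.stab S D u v| ≤ c * PG.normH1 Ωh u * PG.normH1 Ωh v) ∧
        -- weak consistency
        (∀ u : PG.E d → ℝ, PG.MemH2 Ωh u →
          PG.stab S ∅ u u ≤ c * T.meshSize ^ 2 * PG.normH2 Ωh u ^ 2) := by
  have hd0 : 0 < d := by omega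
  -- The summand 2 serves continuity, the other one consistency. Since `patchConst` is a natural
  -- number, the sum is positive whatever the signs of `σ` and `τ`.
  refine ⟨2 + (d + 1 : ℕ) * PG.patchConst d (min 1 (1 / (σ * τ))), by positivity, ?_⟩
  rintro Ω Ωk - - hne hsub T hσ hτ δ - S Ωh hS rfl
  obtain ⟨hM, hh, hκ⟩ := T.isMesh hd0 hσ hτ (T.cells_nonempty (hne.mono hsub)) (S := S)
    (by classical rw [hS]; exact Finset.filter_subset _ _)
  refine ⟨fun D _ u v hu hv => ?_, fun u hu => ?_⟩
  · refine (hM.abs_stab_le D hu hv).trans ?_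
    have h1 : 0 ≤ PG.normH1 (PG.meshDomain S) u := Real.sqrt_nonneg _
    have h2 : 0 ≤ PG.normH1 (PG.meshDomain S) v := Real.sqrt_nonneg _
    rw [mul_assoc]
    gcongr
    exact le_add_of_nonneg_right (by positivity)
  · refine (hM.stab_self_le hd0 hh hκ (min_le_left _ _) hu).trans ?_
    gcongr
    exact le_add_of_nonneg_left (by norm_num)
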